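/- For complex $x,q$ and $n\ge 0$ put $(x;q)_n=\prod_{j=0}^{n-1}(1-xq^j)$ and $(x_1,\dots,x_r;q)_n=\prod_i (x_i;q)_n$. For $|q|<1$ let $a(q)=\sum_{m,n=-\infty}^{\infty}q^{m^2+mn+n^2}$ be the cubic theta function of the Borweins. A pair of complex sequences $(\alpha_n,\beta_n)_{n\ge0}$ is a Bailey pair with respect to $a$ in base $q$ if $\alpha_0=\beta_0=1$ and $\beta_n=\sum_{j=0}^{n}\frac{\alpha_j}{(q;q)_{n-j}(aq;q)_{n+j}}$ for $n>0$. (1) For every complex $q$ with $|q|<1$, the double series for $a(q)$ and all series below converge absolutely, and $$a(q)=1-6\sum_{n=1}^{\infty}\frac{(-1)^n q^{(3n^2-n)/2}}{(q;q^3)_n(1-q^{3n})}+6\sum_{n=1}^{\infty}\frac{(-1)^n q^{(3n^2+n)/2}}{(q^2;q^3)_n(1-q^{3n})}$$ $$=1+6\sum_{n=1}^{\infty}\frac{q^{3n^2-2n}(1-q^{6n-2})}{(1-q^{3n-2})(1-q^{3n})}-6\sum_{n=1}^{\infty}\frac{q^{3n^2-n}(1-q^{6n-1})}{(1-q^{3n-1})(1-q^{3n})}.$$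 (2) Let $0<|q|<1$ and let $(\alpha_n(a,q),\beta_n(a,q))$ be a Bailey pair in which $a$ is a free parameter (it is only needed that $(\alpha_n(a,q^3),\beta_n(a,q^3))$ is a Bailey pair with respect to $a$ in base $q^3$ for $a=q^{-1}$ and for $a=q^{-2}$). If the two series below that contain the $\alpha_n$ converge, then so do the two series that contain the $\beta_n$, and $$a(q)=1+6\sum_{n=1}^{\infty}(q^3;q^3)_{n-1}(-1)^nq^{(3n^2+n)/2}\beta_n(q^{-1},q^3)-6\sum_{n=1}^{\infty}(q^3;q^3)_{n-1}(-1)^nq^{(3n^2-n)/2}\beta_n(q^{-2},q^3)$$ $$-6\sum_{n=1}^{\infty}\frac{(q^3;q^3)_{n-1}(-1)^nq^{(3n^2+n)/2}\alpha_n(q^{-1},q^3)}{(q^2;q^3)_n}+6\sum_{n=1}^{\infty}\frac{(q^3;q^3)_{n-1}(-1)^nq^{(3n^2-n)/2}\alpha_n(q^{-2},q^3)}{(q;q^3)_n}.$$ (3) Let $0<|q|<1$ and let $c,d$ be nonzero complex numbers such that no denominator below vanishes, that is, neither $c$ nor $d$ is of the form $q^{3m+1}$ or $q^{3m+2}$ with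 an integer $m\ge0$. Then all series below converge absolutely and $$a(q)=1+6\sum_{n=1}^{\infty}\frac{(q^3;q^3)_{n-1}(q^2/cd;q^3)_n(-1)^nq^{(3n^2+n)/2}}{(q^2/c,q^2/d,q^3;q^3)_n}-6\sum_{n=1}^{\infty}\frac{(q^3;q^3)_{n-1}(q/cd;q^3)_n(-1)^nq^{(3n^2-n)/2}}{(q/c,q/d,q^3;q^3)_n}$$ $$-6\sum_{n=1}^{\infty}\frac{(1-q^{6n-1})(q^3;q^3)_{n-1}(1/q,c,d;q^3)_n\,q^{3n^2+n}}{(1-1/q)(q^2/c,q^2/d,q^2,q^3;q^3)_n\,c^nd^n}+6\sum_{n=1}^{\infty}\frac{(1-q^{6n-2})(q^3;q^3)_{n-1}(1/q^2,c,d;q^3)_n\,q^{3n^2-n}}{(1-1/q^2)(q/c,q/d,q,q^3;q^3)_n\,c^nd^n}.$$ -/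

import Mathlib

open Filter Topology

/-- The finite `q`-shifted factorial `(x; q)_n = (1 - x)(1 - x q) ⋯ (1 - x q^(n-1))`. -/
noncomputable def qPoch (x q : ℂ) (n : ℕ) : ℂ :=
  ∏ j ∈ Finset.range n, (1 - x * q ^ j)

/-- The Borweins' cubic theta function `a(q) = ∑_{m, n ∈ ℤ} q^(m² + m n + n²)`. -/
noncomputable def cubicTheta (q : ℂ) : ℂ :=
  ∑' p : ℤ × ℤ, q ^ (p.1 ^ 2 + p.1 * p.2 + p.2 ^ 2)

/-- `(α_n, β_n)` is a Bailey pair with respect to `a` (in base `q`): `α_0 = β_0 = 1` and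
`β_n = ∑_{j=0}^n α_j / ((q; q)_{n-j} (a q; q)_{n+j})` for `n > 0`. -/
def IsBaileyPair (a q : ℂ) (α β : ℕ → ℂ) : Prop :=
  α 0 = 1 ∧ β 0 = 1 ∧
    ∀ n : ℕ, 0 < n →
      β n = ∑ j ∈ Finset.range (n + 1),
        1 / (qPoch q q (n - j) * qPoch (a * q) q (n + j)) * α j

/-- The series `∑_{n ≥ 1} u n` converges (in the ordinary sense of partial sums) to `S`. -/
def SeriesTendsTo (u : ℕ → ℂ) (S : ℂ) : Prop :=
  Tendsto (fun N : ℕ => ∑ n ∈ Finset.Icc 1 N, u n) atTop (𝓝 S)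

/-!
For a primitive cube root of unity `ζ`, Jacobi's triple product writes the theta series
`θ(z) = ∑ (-1)^n q^(n(n-1)/2) z^n` as a product of three infinite `q`-factorials. Summing the
triple series `θ(z)³` over the twists `z ↦ ζ^i z` keeps only the terms whose total exponent is
divisible by `3`, and these assemble to `∑ i, θ(ζ^i z)³ = 3 a(q) θ(z³; q³)`. Near `z = 1` both sides
are known from the product side: `θ(1) = 0`, so the twist `i = 0` contributes nothing to the
derivative, while the other two contribute logarithmic derivatives, which are Lambert series.
Comparing derivatives at `z = 1` gives
`a(q) = 1 + 6 (L(q; q³) - L(q²; q³))`, where `L(x; p) = ∑_{j ≥ 0} x p^j / (1 - x p^j)`.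

All the expansions of `a(q)` are now evaluations of `L(x; p)` at `x = q, q²` and `p = q³`. The
first two come from Markov's method: a family of series indexed by `k` whose `k`-th differences
telescope in `n`, passing from the terms of `L` to the terms of the new series. For a
Bailey pair with `x = a p`, insert the definition of `β_n` into
`∑ (p; p)_{n-1} (-1)^n p^(n(n-1)/2) x^n β_n` and exchange the summations: the inner sums over `n`
with `j ≥ 1` collapse to the coefficients of `α_j`, and the term `j = 0` is the alternating
series for `-L(x; p)`. The last identity is this transform applied to the two-parameter pair
obtained from the very-well-poised `₆φ₅` sum, which is verified by a Wilf–Zeilberger certificate.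
-/

section QPochhammer

variable {p x : ℂ}

lemma qPoch_zero (x p : ℂ) : qPoch x p 0 = 1 :=
  Finset.prod_range_zero _

lemma qPoch_succ (x p : ℂ) (n : ℕ) : qPoch x p (n + 1) = qPoch x p n * (1 - x * p ^ n) :=
  Finset.prod_range_succ _ _

lemma qPoch_one (x p : ℂ) : qPoch x p 1 = 1 - x := by
  simp [qPoch]

lemma qPoch_add (x p : ℂ) (m n : ℕ) :
    qPoch x p (m + n) = qPoch x p m * qPoch (x * p ^ m) p n := by
  simp only [qPoch, Finset.prod_range_add, pow_add, mul_assoc]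

lemma qPoch_succ_left (x p : ℂ) (n : ℕ) :
    qPoch x p (n + 1) = (1 - x) * qPoch (x * p) p n := by
  rw [add_comm, qPoch_add, qPoch_one, pow_one]

lemma qPoch_ne_zero (h : ∀ j, 1 - x * p ^ j ≠ 0) (n : ℕ) : qPoch x p n ≠ 0 :=
  Finset.prod_ne_zero_iff.mpr fun j _ => h j

lemma one_sub_ne_zero_of_norm_lt_one (hx : ‖x‖ < 1) : 1 - x ≠ 0 := by
  rw [sub_ne_zero]
  rintro rfl
  simp at hx

lemma norm_pow_lt_one (hp : ‖p‖ < 1) {k : ℕ} (hk : k ≠ 0) : ‖p ^ k‖ < 1 := by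
  rw [norm_pow]
  exact pow_lt_one₀ (norm_nonneg p) hp hk

lemma one_sub_pow_succ_ne_zero (hp : ‖p‖ < 1) (n : ℕ) : 1 - p ^ (n + 1) ≠ 0 :=
  one_sub_ne_zero_of_norm_lt_one (norm_pow_lt_one hp n.succ_ne_zero)

lemma norm_mul_pow_lt_one (hp : ‖p‖ < 1) (hx : ‖x‖ < 1) (j : ℕ) : ‖x * p ^ j‖ < 1 := by
  rw [norm_mul, norm_pow]
  exact mul_lt_one_of_nonneg_of_lt_one_left (norm_nonneg x) hx (pow_le_one₀ (norm_nonneg p) hp.le)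

lemma one_sub_mul_pow_ne_zero (hp : ‖p‖ < 1) (hx : ‖x‖ < 1) (j : ℕ) : 1 - x * p ^ j ≠ 0 :=
  one_sub_ne_zero_of_norm_lt_one (norm_mul_pow_lt_one hp hx j)

lemma qPoch_self_ne_zero (hp : ‖p‖ < 1) (n : ℕ) : qPoch p p n ≠ 0 :=
  qPoch_ne_zero (one_sub_mul_pow_ne_zero hp hp) n

/-- The infinite product `(x; p)_∞ = ∏ j, (1 - x p^j)`, meaningful for `‖p‖ < 1`. -/
noncomputable def qPochInf (x p : ℂ) : ℂ :=
  ∏' j : ℕ, (1 - x * p ^ j)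

lemma summable_norm_mul_pow (hp : ‖p‖ < 1) (x : ℂ) : Summable fun j : ℕ => ‖x * p ^ j‖ := by
  simpa only [norm_mul, norm_pow] using
    (summable_geometric_of_lt_one (norm_nonneg p) hp).mul_left ‖x‖

lemma tendsto_qPoch (hp : ‖p‖ < 1) (x : ℂ) : Tendsto (qPoch x p) atTop (𝓝 (qPochInf x p)) := by
  have h : Multipliable fun j : ℕ => 1 - x * p ^ j := by
    simpa only [sub_eq_add_neg] using multipliable_one_add_of_summable
      (f := fun j : ℕ => -(x * p ^ j)) (by simpa only [norm_neg] using summable_norm_mul_pow hp x)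
  exact h.hasProd.tendsto_prod_nat

lemma qPochInf_ne_zero (hp : ‖p‖ < 1) (h : ∀ j, 1 - x * p ^ j ≠ 0) : qPochInf x p ≠ 0 := by
  simpa only [qPochInf, sub_eq_add_neg] using tprod_one_add_ne_zero_of_summable
    (f := fun j : ℕ => -(x * p ^ j)) (fun j => by simpa only [sub_eq_add_neg] using h j)
    (by simpa only [norm_neg] using summable_norm_mul_pow hp x)

lemma qPoch_mul_qPochInf (hp : ‖p‖ < 1) (x : ℂ) (n : ℕ) :
    qPoch x p n * qPochInf (x * p ^ n) p = qPochInf x p := by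
  refine tendsto_nhds_unique ((tendsto_qPoch hp (x * p ^ n)).const_mul (qPoch x p n)) ?_
  simp only [← qPoch_add, add_comm n]
  exact (tendsto_qPoch hp x).comp (tendsto_add_atTop_nat n)

lemma exists_norm_qPoch_le (hp : ‖p‖ < 1) (x : ℂ) : ∃ C, ∀ n, ‖qPoch x p n‖ ≤ C :=
  (tendsto_qPoch hp x).norm.bddAbove_range.imp fun _ hC n => hC ⟨n, rfl⟩

lemma exists_norm_qPoch_inv_le (hp : ‖p‖ < 1) (h : ∀ j, 1 - x * p ^ j ≠ 0) :
    ∃ C, ∀ n, ‖(qPoch x p n)⁻¹‖ ≤ C :=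
  ((tendsto_qPoch hp x).inv₀ (qPochInf_ne_zero hp h)).norm.bddAbove_range.imp
    fun _ hC n => hC ⟨n, rfl⟩

lemma qPoch_mul_pow (h : ∀ j, 1 - x * p ^ j ≠ 0) (n k : ℕ) :
    qPoch (x * p ^ n) p k = qPoch x p (n + k) * (qPoch x p n)⁻¹ := by
  rw [qPoch_add, mul_right_comm, mul_inv_cancel₀ (qPoch_ne_zero h n), one_mul]

lemma exists_norm_qPoch_mul_pow_le (hp : ‖p‖ < 1) (h : ∀ j, 1 - x * p ^ j ≠ 0) :
    ∃ C, ∀ n k, ‖qPoch (x * p ^ n) p k‖ ≤ C := by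
  obtain ⟨C, hC⟩ := exists_norm_qPoch_le hp x
  obtain ⟨D, hD⟩ := exists_norm_qPoch_inv_le hp h
  refine ⟨C * D, fun n k => ?_⟩
  rw [qPoch_mul_pow h, norm_mul]
  exact mul_le_mul (hC _) (hD _) (norm_nonneg _) ((norm_nonneg _).trans (hC 0))

lemma exists_norm_qPoch_mul_pow_inv_le (hp : ‖p‖ < 1) (h : ∀ j, 1 - x * p ^ j ≠ 0) :
    ∃ C, ∀ n k, ‖(qPoch (x * p ^ n) p k)⁻¹‖ ≤ C := by
  obtain ⟨C, hC⟩ := exists_norm_qPoch_le hp x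
  obtain ⟨D, hD⟩ := exists_norm_qPoch_inv_le hp h
  refine ⟨D * C, fun n k => ?_⟩
  rw [qPoch_mul_pow h, mul_inv, inv_inv, norm_mul]
  exact mul_le_mul (hD _) (hC _) (norm_nonneg _) ((norm_nonneg _).trans (hD 0))

lemma exists_norm_one_sub_mul_pow_inv_le (hp : ‖p‖ < 1) (h : ∀ j, 1 - x * p ^ j ≠ 0) :
    ∃ C, ∀ n, ‖(1 - x * p ^ n)⁻¹‖ ≤ C := by
  obtain ⟨C, hC⟩ := exists_norm_qPoch_mul_pow_inv_le hp h
  exact ⟨C, fun n => by simpa only [qPoch_one] using hC n 1⟩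

lemma exists_norm_one_sub_pow_succ_inv_le (hp : ‖p‖ < 1) :
    ∃ C, ∀ n, ‖(1 - p ^ (n + 1))⁻¹‖ ≤ C := by
  simpa only [pow_succ'] using
    exists_norm_one_sub_mul_pow_inv_le hp (one_sub_mul_pow_ne_zero hp hp)

lemma choose_two_succ (n : ℕ) : (n + 1).choose 2 = n.choose 2 + n := by
  rw [Nat.choose_succ_succ', Nat.choose_one_right, add_comm]

lemma summable_pow_choose_two_mul_pow {r : ℝ} (hr : 0 ≤ r) (hr1 : r < 1) (b : ℝ) :
    Summable fun k : ℕ => r ^ (k.choose 2) * b ^ k := by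
  have h : Tendsto (fun k : ℕ => r ^ k * |b|) atTop (𝓝 0) := by
    simpa using (tendsto_pow_atTop_nhds_zero_of_lt_one hr hr1).mul_const |b|
  refine summable_of_ratio_norm_eventually_le (r := 1 / 2) (by norm_num) ?_
  filter_upwards [h.eventually (gt_mem_nhds one_half_pos)] with k hk
  calc ‖r ^ ((k + 1).choose 2) * b ^ (k + 1)‖
      = r ^ k * |b| * ‖r ^ (k.choose 2) * b ^ k‖ := by
        simp only [choose_two_succ, norm_mul, norm_pow, Real.norm_eq_abs, abs_of_nonneg hr]
        ring
    _ ≤ 1 / 2 * ‖r ^ (k.choose 2) * b ^ k‖ := by gcongr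

lemma summable_pow_choose_two_mul_pow_succ {r : ℝ} (hr : 0 ≤ r) (hr1 : r < 1) (b : ℝ) :
    Summable fun k : ℕ => r ^ ((k + 1).choose 2) * b ^ (k + 1) :=
  (summable_nat_add_iff 1).mpr (summable_pow_choose_two_mul_pow hr hr1 b)

end QPochhammer

section LambertSeries

/-- Markov's method for transforming series. -/
lemma hasSum_of_telescoping_differences {u A : ℕ → ℕ → ℂ} {r : ℝ} {b : ℕ → ℝ} {S : ℂ}
    (hr0 : 0 ≤ r) (hr : r < 1) (hb : Summable b) (hu : ∀ k n, ‖u k n‖ ≤ r ^ k * b n)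
    (h : ∀ k n, u k n - u (k + 1) n = A k n - A k (n + 1))
    (hA : ∀ k, Tendsto (A k) atTop (𝓝 0))
    (hS : Tendsto (fun K => ∑ k ∈ Finset.range K, A k 0) atTop (𝓝 S)) :
    HasSum (u 0) S := by
  have hs (k : ℕ) : Summable (u k) := .of_norm_bounded (hb.mul_left (r ^ k)) (hu k)
  have hdiff (k : ℕ) : ∑' n, u k n - ∑' n, u (k + 1) n = A k 0 := by
    rw [← (hs k).tsum_sub (hs (k + 1))]
    refine tendsto_nhds_unique ((hs k).sub (hs (k + 1))).hasSum.tendsto_sum_nat ?_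
    simpa only [h, Finset.sum_range_sub', sub_zero] using (hA k).const_sub (A k 0)
  have hrow : Tendsto (fun k => ∑' n, u k n) atTop (𝓝 0) := by
    refine squeeze_zero_norm (a := fun k => r ^ k * ∑' n, b n)
      (fun k => tsum_of_norm_bounded (hb.hasSum.mul_left (r ^ k)) (hu k)) ?_
    simpa using (tendsto_pow_atTop_nhds_zero_of_lt_one hr0 hr).mul_const (∑' n, b n)
  have hlim : Tendsto (fun K => ∑ k ∈ Finset.range K, A k 0) atTop (𝓝 (∑' n, u 0 n)) := by
    simpa only [← hdiff, Finset.sum_range_sub', sub_zero] using hrow.const_sub (∑' n, u 0 n)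
  rw [tendsto_nhds_unique hS hlim]
  exact (hs 0).hasSum

variable {p x : ℂ}

/-- The Lambert series `∑ x p^i / (1 - x p^i)` over `i ≥ 0`, that is, `-x` times the logarithmic
derivative of `(x; p)_∞` in `x`. -/
noncomputable def lambertSeries (x p : ℂ) : ℂ :=
  ∑' i : ℕ, x * p ^ i / (1 - x * p ^ i)

lemma summable_lambertSeries (hp : ‖p‖ < 1) (h : ∀ j, 1 - x * p ^ j ≠ 0) :
    Summable fun i : ℕ => x * p ^ i / (1 - x * p ^ i) := by
  obtain ⟨C, hC⟩ := exists_norm_one_sub_mul_pow_inv_le hp h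
  refine .of_norm_bounded ((summable_norm_mul_pow hp x).mul_right C) fun i => ?_
  rw [div_eq_mul_inv, norm_mul]
  exact mul_le_mul_of_nonneg_left (hC i) (norm_nonneg _)

lemma hasSum_lambertSeries (hp : ‖p‖ < 1) (h : ∀ j, 1 - x * p ^ j ≠ 0) :
    HasSum (fun i : ℕ => x * p ^ i / (1 - x * p ^ i)) (lambertSeries x p) :=
  (summable_lambertSeries hp h).hasSum

lemma norm_mul_pow_pow_succ_le (hp : ‖p‖ < 1) (x : ℂ) (k n : ℕ) :
    ‖(x * p ^ k) ^ (n + 1)‖ ≤ ‖p‖ ^ k * ‖x‖ ^ (n + 1) := by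
  rw [mul_pow, norm_mul, ← pow_mul, norm_pow, norm_pow, mul_comm]
  gcongr ?_ * _
  exact pow_le_pow_of_le_one (norm_nonneg p) hp.le (Nat.le_mul_of_pos_right k n.succ_pos)

lemma one_sub_mul_pow_mul_pow_ne_zero (h : ∀ j, 1 - x * p ^ j ≠ 0) (k j : ℕ) :
    1 - x * p ^ k * p ^ j ≠ 0 := by
  rw [mul_assoc, ← pow_add]
  exact h (k + j)

theorem hasSum_pow_div_one_sub_pow (hp : ‖p‖ < 1) (hx : ‖x‖ < 1) :
    HasSum (fun n : ℕ => x ^ (n + 1) / (1 - p ^ (n + 1))) (lambertSeries x p) := by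
  obtain ⟨C, hC⟩ := exists_norm_one_sub_pow_succ_inv_le hp
  have hb : Summable fun n : ℕ => ‖x‖ ^ (n + 1) * C :=
    ((summable_nat_add_iff 1).mpr (summable_geometric_of_lt_one (norm_nonneg x) hx)).mul_right C
  have key := hasSum_of_telescoping_differences (S := lambertSeries x p)
    (u := fun k n => (x * p ^ k) ^ (n + 1) / (1 - p ^ (n + 1)))
    (A := fun k n => (x * p ^ k) ^ (n + 1) / (1 - x * p ^ k))
    (norm_nonneg p) hp hb (fun k n => ?_) (fun k n => ?_) (fun k => ?_) ?_
  · simpa using key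
  · rw [div_eq_mul_inv, norm_mul, ← mul_assoc]
    exact mul_le_mul (norm_mul_pow_pow_succ_le hp x k n) (hC n) (norm_nonneg _) (by positivity)
  · have h1 := one_sub_pow_succ_ne_zero hp n
    have h2 := one_sub_mul_pow_ne_zero hp hx k
    rw [pow_succ p k]
    field_simp
    ring
  · simpa using ((tendsto_pow_atTop_nhds_zero_of_norm_lt_one
      (norm_mul_pow_lt_one hp hx k)).comp (tendsto_add_atTop_nat 1)).div_const (1 - x * p ^ k)
  · simpa using (hasSum_lambertSeries hp (one_sub_mul_pow_ne_zero hp hx)).tendsto_sum_nat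

lemma tendsto_pow_choose_two_mul_pow_div_qPoch (hp : ‖p‖ < 1) (h : ∀ j, 1 - x * p ^ j ≠ 0) :
    Tendsto (fun n => (-1) ^ n * p ^ (n.choose 2) * x ^ n / qPoch x p n) atTop (𝓝 0) := by
  obtain ⟨C, hC⟩ := exists_norm_qPoch_inv_le hp h
  have hs := (summable_pow_choose_two_mul_pow (norm_nonneg p) hp ‖x‖).mul_right C
  refine squeeze_zero_norm (fun n => ?_) hs.tendsto_atTop_zero
  rw [div_eq_mul_inv]
  simp only [norm_mul, norm_pow, norm_neg, norm_one, one_pow, one_mul]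
  gcongr
  exact hC n

lemma norm_pow_div_qPoch_mul_pow_le (hp : ‖p‖ < 1) {C D : ℝ}
    (hC : ∀ n k, ‖(qPoch (x * p ^ n) p k)⁻¹‖ ≤ C) (hD : ∀ n, ‖(1 - p ^ (n + 1))⁻¹‖ ≤ D)
    (k n : ℕ) :
    ‖(-1) ^ (n + 1) * p ^ ((n + 1).choose 2) * (x * p ^ k) ^ (n + 1) /
        (qPoch (x * p ^ k) p (n + 1) * (1 - p ^ (n + 1)))‖ ≤
      ‖p‖ ^ k * (‖p‖ ^ ((n + 1).choose 2) * ‖x‖ ^ (n + 1) * (C * D)) := by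
  have hC0 : 0 ≤ C := (norm_nonneg _).trans (hC 0 0)
  calc ‖_‖ = ‖p‖ ^ ((n + 1).choose 2) * ‖(x * p ^ k) ^ (n + 1)‖ *
        (‖(qPoch (x * p ^ k) p (n + 1))⁻¹‖ * ‖(1 - p ^ (n + 1))⁻¹‖) := by
        rw [div_eq_mul_inv, mul_inv]
        simp only [norm_mul, norm_pow, norm_neg, norm_one, one_pow, one_mul]
    _ ≤ ‖p‖ ^ ((n + 1).choose 2) * (‖p‖ ^ k * ‖x‖ ^ (n + 1)) * (C * D) := by
        gcongr
        · exact norm_mul_pow_pow_succ_le hp x k n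
        · exact hC k (n + 1)
        · exact hD n
    _ = _ := by ring

theorem hasSum_lambertSeries_alternating (hp : ‖p‖ < 1) (h : ∀ j, 1 - x * p ^ j ≠ 0) :
    HasSum (fun n : ℕ => (-1) ^ (n + 1) * p ^ ((n + 1).choose 2) * x ^ (n + 1) /
      (qPoch x p (n + 1) * (1 - p ^ (n + 1)))) (-lambertSeries x p) := by
  obtain ⟨C, hC⟩ := exists_norm_qPoch_mul_pow_inv_le hp h
  obtain ⟨D, hD⟩ := exists_norm_one_sub_pow_succ_inv_le hp
  have hb : Summable fun n : ℕ => ‖p‖ ^ ((n + 1).choose 2) * ‖x‖ ^ (n + 1) * (C * D) :=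
    (summable_pow_choose_two_mul_pow_succ (norm_nonneg p) hp ‖x‖).mul_right (C * D)
  have key := hasSum_of_telescoping_differences (S := -lambertSeries x p)
    (A := fun k n => (-1) ^ (n + 1) * p ^ ((n + 1).choose 2) * (x * p ^ k) ^ (n + 1) /
      qPoch (x * p ^ k) p (n + 1))
    (norm_nonneg p) hp hb (norm_pow_div_qPoch_mul_pow_le hp hC hD) (fun k n => ?_) (fun k => ?_) ?_
  · simpa only [pow_zero, mul_one] using key
  · have hne := one_sub_mul_pow_mul_pow_ne_zero h k
    have h1 := one_sub_pow_succ_ne_zero hp n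
    have h2 : 1 - x * p ^ k ≠ 0 := h k
    have h3 : qPoch (x * p ^ k * p) p n ≠ 0 :=
      qPoch_ne_zero (fun j => by simpa only [mul_assoc, ← pow_succ'] using hne (j + 1)) n
    have h4 : 1 - x * p ^ k * p ^ (n + 1) ≠ 0 := hne (n + 1)
    rw [qPoch_succ _ _ (n + 1), choose_two_succ (n + 1), pow_succ p k, ← mul_assoc x,
      qPoch_succ (x * p ^ k * p) p n, mul_assoc (x * p ^ k) p, ← pow_succ' p n,
      qPoch_succ_left (x * p ^ k)]
    field_simp
    ring
  · exact (tendsto_pow_choose_two_mul_pow_div_qPoch hp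
      (one_sub_mul_pow_mul_pow_ne_zero h k)).comp (tendsto_add_atTop_nat 1)
  · simpa [qPoch_one, neg_div] using (hasSum_lambertSeries hp h).tendsto_sum_nat.neg

lemma norm_clausen_term_le (hp : ‖p‖ < 1) {C D : ℝ}
    (hC : ∀ n, ‖(1 - x * p ^ n)⁻¹‖ ≤ C) (hD : ∀ n, ‖(1 - p ^ (n + 1))⁻¹‖ ≤ D) (k n : ℕ) :
    ‖(x * p ^ k) ^ (n + 1) * (p ^ ((n + 1).choose 2)) ^ 2 * (1 - x * p ^ k * p ^ (2 * n + 1)) /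
        ((1 - x * p ^ k * p ^ n) * (1 - p ^ (n + 1)))‖ ≤
      ‖p‖ ^ k * ((‖p‖ ^ 2) ^ ((n + 1).choose 2) * ‖x‖ ^ (n + 1) * ((1 + ‖x‖) * (C * D))) := by
  have hC0 : 0 ≤ C := (norm_nonneg _).trans (hC 0)
  have hnum : ‖1 - x * p ^ k * p ^ (2 * n + 1)‖ ≤ 1 + ‖x‖ := by
    refine (norm_sub_le _ _).trans ?_
    rw [norm_one, mul_assoc, ← pow_add, norm_mul, norm_pow]
    gcongr
    exact mul_le_of_le_one_right (norm_nonneg x) (pow_le_one₀ (norm_nonneg p) hp.le)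
  calc ‖_‖ = ‖(x * p ^ k) ^ (n + 1)‖ * (‖p‖ ^ 2) ^ ((n + 1).choose 2) *
        (‖1 - x * p ^ k * p ^ (2 * n + 1)‖ *
          (‖(1 - x * p ^ (k + n))⁻¹‖ * ‖(1 - p ^ (n + 1))⁻¹‖)) := by
        rw [div_eq_mul_inv, mul_inv, mul_assoc x (p ^ k) (p ^ n), ← pow_add p k n]
        simp only [norm_mul, norm_pow, ← pow_mul, mul_comm 2, mul_assoc]
    _ ≤ (‖p‖ ^ k * ‖x‖ ^ (n + 1)) * (‖p‖ ^ 2) ^ ((n + 1).choose 2) *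
        ((1 + ‖x‖) * (C * D)) := by
        gcongr
        · exact norm_mul_pow_pow_succ_le hp x k n
        · exact hC (k + n)
        · exact hD n
    _ = _ := by ring

theorem hasSum_lambertSeries_clausen (hp : ‖p‖ < 1) (h : ∀ j, 1 - x * p ^ j ≠ 0) :
    HasSum (fun n : ℕ => x ^ (n + 1) * (p ^ ((n + 1).choose 2)) ^ 2 * (1 - x * p ^ (2 * n + 1)) /
      ((1 - x * p ^ n) * (1 - p ^ (n + 1)))) (lambertSeries x p) := by
  obtain ⟨C, hC⟩ := exists_norm_one_sub_mul_pow_inv_le hp h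
  obtain ⟨D, hD⟩ := exists_norm_one_sub_pow_succ_inv_le hp
  have hb : Summable fun n : ℕ => (‖p‖ ^ 2) ^ ((n + 1).choose 2) * ‖x‖ ^ (n + 1) :=
    summable_pow_choose_two_mul_pow_succ (sq_nonneg ‖p‖)
      (pow_lt_one₀ (norm_nonneg p) hp two_ne_zero) ‖x‖
  have key := hasSum_of_telescoping_differences (S := lambertSeries x p)
    (A := fun k n => (x * p ^ k) ^ (n + 1) * (p ^ ((n + 1).choose 2)) ^ 2 /
      (1 - x * p ^ k * p ^ n))
    (norm_nonneg p) hp (hb.mul_right ((1 + ‖x‖) * (C * D))) (norm_clausen_term_le hp hC hD)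
    (fun k n => ?_) (fun k => ?_) ?_
  · simpa only [pow_zero, mul_one] using key
  · have hne := one_sub_mul_pow_mul_pow_ne_zero h k
    have h1 := one_sub_pow_succ_ne_zero hp n
    have h2 := hne n
    have h3 := hne (n + 1)
    rw [choose_two_succ (n + 1), pow_succ p k, ← mul_assoc x, mul_assoc (x * p ^ k) p (p ^ n),
      ← pow_succ' p n]
    field_simp
    ring
  · refine squeeze_zero_norm (fun n => ?_) (hb.mul_right C).tendsto_atTop_zero
    have hpow : ‖(x * p ^ k) ^ (n + 1)‖ ≤ ‖x‖ ^ (n + 1) :=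
      (norm_mul_pow_pow_succ_le hp x k n).trans
        (mul_le_of_le_one_left (by positivity) (pow_le_one₀ (norm_nonneg p) hp.le))
    rw [div_eq_mul_inv, mul_assoc x, ← pow_add, norm_mul, norm_mul, norm_pow (p ^ _), norm_pow p,
      mul_comm (‖(x * p ^ k) ^ (n + 1)‖), ← pow_mul, mul_comm _ 2, pow_mul]
    gcongr
    exact hC (k + n)
  · simpa using (hasSum_lambertSeries hp h).tendsto_sum_nat

end LambertSeries

section PhiSum

variable {p a y : ℂ}

/-- The `k`-th term of the basic hypergeometric series `₁φ₁(a; a y; p, y)`. -/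
noncomputable def phiTerm (p a y : ℂ) (k : ℕ) : ℂ :=
  qPoch a p k * (-1) ^ k * p ^ (k.choose 2) * y ^ k / (qPoch p p k * qPoch (a * y) p k)

lemma phiTerm_zero (p a y : ℂ) : phiTerm p a y 0 = 1 := by
  simp [phiTerm, qPoch_zero]

lemma norm_phiTerm_mul_pow_succ_le (hp : ‖p‖ < 1) {n : ℕ} {C D E : ℝ}
    (hC : ∀ k, ‖qPoch a p k‖ ≤ C) (hD : ∀ k, ‖(qPoch p p k)⁻¹‖ ≤ D)
    (hE : ∀ k, ‖(qPoch (a * (y * p ^ n)) p k)⁻¹‖ ≤ E) (k : ℕ) :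
    ‖phiTerm p a (y * p ^ n) (k + 1)‖ ≤
      ‖p‖ ^ n * (‖p‖ ^ ((k + 1).choose 2) * ‖y‖ ^ (k + 1) * (C * (D * E))) := by
  have hC0 : 0 ≤ C := (norm_nonneg _).trans (hC 0)
  have hD0 : 0 ≤ D := (norm_nonneg _).trans (hD 0)
  calc ‖phiTerm p a (y * p ^ n) (k + 1)‖
      = ‖qPoch a p (k + 1)‖ * ‖p‖ ^ ((k + 1).choose 2) * ‖(y * p ^ n) ^ (k + 1)‖ *
        (‖(qPoch p p (k + 1))⁻¹‖ * ‖(qPoch (a * (y * p ^ n)) p (k + 1))⁻¹‖) := by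
        rw [phiTerm, div_eq_mul_inv, mul_inv]
        simp only [norm_mul, norm_pow, norm_neg, norm_one, one_pow, mul_one]
    _ ≤ C * ‖p‖ ^ ((k + 1).choose 2) * (‖p‖ ^ n * ‖y‖ ^ (k + 1)) * (D * E) := by
        gcongr
        · exact hC _
        · exact norm_mul_pow_pow_succ_le hp y n k
        · exact hD _
        · exact hE _
    _ = _ := by ring

lemma phiTerm_sub_phiTerm_mul (hp : ‖p‖ < 1) (h : ∀ j, 1 - a * y * p ^ j ≠ 0) (n : ℕ) :
    phiTerm p a y n - (1 - y) / (1 - a * y) * phiTerm p a (y * p) n =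
      (1 - p ^ n) * phiTerm p a y n - (1 - p ^ (n + 1)) * phiTerm p a y (n + 1) := by
  have h0 : 1 - a * y ≠ 0 := by simpa using h 0
  have h1 := one_sub_pow_succ_ne_zero hp n
  have h2 := qPoch_self_ne_zero hp n
  have h3 := qPoch_ne_zero h n
  have h4 := h n
  have hshift : qPoch (a * (y * p)) p n =
      qPoch (a * y) p n * (1 - a * y * p ^ n) / (1 - a * y) := by
    rw [eq_div_iff h0, mul_comm, ← mul_assoc a, ← qPoch_succ_left, qPoch_succ]
  simp only [phiTerm, hshift, qPoch_succ, choose_two_succ, ← pow_succ' p n]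
  field_simp
  ring

lemma one_sub_mul_phiTerm_one (hp : ‖p‖ < 1) (h : ∀ j, 1 - a * y * p ^ j ≠ 0) :
    (1 - p) * phiTerm p a y 1 = (1 - y) / (1 - a * y) - 1 := by
  have h0 := phiTerm_sub_phiTerm_mul hp h 0
  simp only [phiTerm_zero, pow_zero, sub_self, zero_mul, zero_add, pow_one] at h0
  linear_combination h0

lemma tendsto_phiTerm (hp : ‖p‖ < 1) (h : ∀ j, 1 - a * y * p ^ j ≠ 0) :
    Tendsto (phiTerm p a y) atTop (𝓝 0) := by
  obtain ⟨C, hC⟩ := exists_norm_qPoch_le hp a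
  obtain ⟨D, hD⟩ := exists_norm_qPoch_inv_le hp (one_sub_mul_pow_ne_zero hp hp)
  obtain ⟨E, hE⟩ := exists_norm_qPoch_inv_le hp h
  have hb := (summable_pow_choose_two_mul_pow_succ (norm_nonneg p) hp ‖y‖).mul_right (C * (D * E))
  refine (tendsto_add_atTop_iff_nat 1).mp (squeeze_zero_norm (fun k => ?_) hb.tendsto_atTop_zero)
  simpa using norm_phiTerm_mul_pow_succ_le (n := 0) hp hC hD (by simpa using hE) k

/-- The quotients `(y; p)_k / (a y; p)_k` are the partial sums of the series into which Markov's
method transforms `₁φ₁(a; a y; p, y)`. -/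
theorem hasSum_phiTerm (hp : ‖p‖ < 1) (h : ∀ j, 1 - a * y * p ^ j ≠ 0) :
    HasSum (phiTerm p a y) (qPochInf y p / qPochInf (a * y) p) := by
  let R (k : ℕ) : ℂ := qPoch y p k / qPoch (a * y) p k
  have hR : Tendsto R atTop (𝓝 (qPochInf y p / qPochInf (a * y) p)) :=
    (tendsto_qPoch hp y).div (tendsto_qPoch hp (a * y)) (qPochInf_ne_zero hp h)
  have hR0 : R 0 = 1 := by simp [R, qPoch_zero]
  have hR_succ (k : ℕ) : R (k + 1) = R k * ((1 - y * p ^ k) / (1 - a * (y * p ^ k))) := by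
    simp only [R, qPoch_succ, mul_div_mul_comm, mul_assoc]
  have hk (k j : ℕ) : 1 - a * (y * p ^ k) * p ^ j ≠ 0 := by
    simpa only [mul_assoc, pow_add] using h (k + j)
  have hphi (k n : ℕ) := phiTerm_sub_phiTerm_mul hp (hk k) n
  obtain ⟨B, hB⟩ := hR.norm.bddAbove_range
  obtain ⟨C, hC⟩ := exists_norm_qPoch_le hp a
  obtain ⟨D, hD⟩ := exists_norm_qPoch_inv_le hp (one_sub_mul_pow_ne_zero hp hp)
  obtain ⟨E, hE⟩ := exists_norm_qPoch_mul_pow_inv_le hp h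
  have hb := (summable_pow_choose_two_mul_pow_succ (norm_nonneg p) hp ‖y‖).mul_right (C * (D * E))
  have key : HasSum (fun n => R 0 * phiTerm p a (y * p ^ 0) (n + 1))
      (qPochInf y p / qPochInf (a * y) p - 1) := by
    refine hasSum_of_telescoping_differences (u := fun k n => R k * phiTerm p a (y * p ^ k) (n + 1))
      (A := fun k n => R k * ((1 - p ^ (n + 1)) * phiTerm p a (y * p ^ k) (n + 1)))
      (norm_nonneg p) hp (hb.mul_left B) (fun k n => ?_) (fun k n => ?_) (fun k => ?_) ?_
    · rw [norm_mul, mul_left_comm]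
      refine mul_le_mul (hB ⟨k, rfl⟩) ?_ (norm_nonneg _) ((norm_nonneg _).trans (hB ⟨0, rfl⟩))
      exact norm_phiTerm_mul_pow_succ_le hp hC hD (by simpa only [mul_assoc] using hE k) n
    · rw [hR_succ, pow_succ p k, ← mul_assoc y]
      linear_combination R k * hphi k (n + 1)
    · have hpow := (tendsto_pow_atTop_nhds_zero_of_norm_lt_one hp).const_sub 1
      simpa [Function.comp_def] using ((hpow.mul (tendsto_phiTerm hp (hk k))).const_mul
        (R k)).comp (tendsto_add_atTop_nat 1)
    · have hdiff (k : ℕ) : R k * ((1 - p ^ (0 + 1)) * phiTerm p a (y * p ^ k) (0 + 1)) =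
          R (k + 1) - R k := by
        rw [zero_add, pow_one, one_sub_mul_phiTerm_one hp (hk k), hR_succ, mul_sub, mul_one]
      simpa only [hdiff, Finset.sum_range_sub, hR0] using hR.sub_const 1
  rw [← hasSum_nat_add_iff' 1]
  simpa [hR0, phiTerm_zero] using key

/-- The case `a = p ^ j`, in which the quotient of infinite products is finite. -/
lemma hasSum_phiTerm_pow (hp : ‖p‖ < 1) {j : ℕ} (h : ∀ i, 1 - y * p ^ j * p ^ i ≠ 0) :
    HasSum (phiTerm p (p ^ j) y) (qPoch y p j) := by
  rw [← mul_div_cancel_right₀ (qPoch y p j) (qPochInf_ne_zero hp h), qPoch_mul_qPochInf hp,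
    mul_comm y]
  exact hasSum_phiTerm hp (by simpa only [mul_comm y] using h)

end PhiSum

section BaileyTransform

variable {p x : ℂ}

lemma norm_sum_range_succ_sub_le {f : ℕ → ℂ} {s : ℂ} {g : ℕ → ℝ} {G : ℝ} (hf : HasSum f s)
    (hg : HasSum g G) (hfg : ∀ k, ‖f (k + 1)‖ ≤ g k) (m : ℕ) :
    ‖∑ k ∈ Finset.range (m + 1), f k - s‖ ≤ G := by
  have htail : HasSum (fun k => f (k + (m + 1))) (s - ∑ k ∈ Finset.range (m + 1), f k) :=
    (hasSum_nat_add_iff' (m + 1)).mpr hf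
  have hg0 (k : ℕ) : 0 ≤ g k := (norm_nonneg _).trans (hfg k)
  rw [norm_sub_rev, ← htail.tsum_eq]
  refine (tsum_of_norm_bounded ((summable_nat_add_iff m).mpr hg.summable).hasSum
    fun k => hfg (k + m)).trans ?_
  rw [← hg.tsum_eq, ← hg.summable.sum_add_tsum_nat_add m]
  exact le_add_of_nonneg_left (Finset.sum_nonneg fun k _ => hg0 k)

lemma tendsto_sum_range_sub_zero {e : ℕ → ℕ → ℂ} {b : ℕ → ℝ} (hb : Summable b)
    (he : ∀ j m, ‖e j (m + 1)‖ ≤ b j) (he0 : ∀ j, Tendsto (e j) atTop (𝓝 0)) :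
    Tendsto (fun N => ∑ j ∈ Finset.range N, e j (N - j)) atTop (𝓝 0) := by
  let f (N j : ℕ) : ℂ := if j < N then e j (N - j) else 0
  have hf (N j : ℕ) : ‖f N j‖ ≤ b j := by
    by_cases hj : j < N
    · obtain ⟨m, rfl⟩ := Nat.exists_eq_add_of_lt hj
      rw [show f (j + m + 1) j = e j (m + 1) by simp only [f, if_pos hj]; congr 1; omega]
      exact he j m
    · simpa only [f, if_neg hj, norm_zero] using (norm_nonneg _).trans (he j 0)
  have hf0 (j : ℕ) : Tendsto (f · j) atTop (𝓝 0) := by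
    refine ((he0 j).comp (tendsto_sub_atTop_nat j)).congr' ?_
    filter_upwards [eventually_gt_atTop j] with N hN
    exact (if_pos hN).symm
  have hlim := tendsto_tsum_of_dominated_convergence hb hf0 (.of_forall fun N => hf N)
  rw [tsum_zero] at hlim
  refine hlim.congr fun N => ?_
  rw [tsum_eq_sum (s := Finset.range N) fun j hj => if_neg (by simpa using hj)]
  exact Finset.sum_congr rfl fun j hj => if_pos (Finset.mem_range.mp hj)

/-- `∑ T j` need not converge absolutely: only the difference of the two sides is estimated. -/
lemma tendsto_sum_mul_sum_range_sub {T : ℕ → ℂ} {w : ℕ → ℕ → ℂ} {b g : ℕ → ℝ} {A : ℂ}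
    (hT : Tendsto (fun N => ∑ j ∈ Finset.range N, T j) atTop (𝓝 A))
    (hw : ∀ j, HasSum (w j) 1) (hb : Summable b) (hg : Summable g)
    (hwb : ∀ j k, ‖w j (k + 1)‖ ≤ b j * g k) :
    Tendsto (fun N => ∑ j ∈ Finset.range N, T j * ∑ k ∈ Finset.range (N - j), w j k)
      atTop (𝓝 A) := by
  have hT0 : Tendsto T atTop (𝓝 0) := by
    simpa [Finset.sum_range_succ, Function.comp_def] using
      (hT.comp (tendsto_add_atTop_nat 1)).sub hT
  obtain ⟨M, hM⟩ := hT0.norm.bddAbove_range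
  have hdiff := tendsto_sum_range_sub_zero
    (e := fun j m => T j * (∑ k ∈ Finset.range m, w j k - 1))
    ((hb.mul_right (∑' k, g k)).mul_left M) (fun j m => ?_) (fun j => ?_)
  · rw [← add_zero A]
    refine (hT.add hdiff).congr fun N => ?_
    rw [← Finset.sum_add_distrib]
    exact Finset.sum_congr rfl fun j _ => by ring
  · have hTj : ‖T j‖ ≤ M := hM ⟨j, rfl⟩
    rw [norm_mul]
    exact mul_le_mul hTj (norm_sum_range_succ_sub_le (hw j) (hg.hasSum.mul_left (b j)) (hwb j) m)
      (norm_nonneg _) ((norm_nonneg _).trans hTj)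
  · simpa using ((hw j).tendsto_sum_nat.sub_const 1).const_mul (T j)

lemma sum_range_sum_range_succ (F : ℕ → ℕ → ℂ) (N : ℕ) :
    ∑ n ∈ Finset.range N, ∑ j ∈ Finset.range (n + 1), F n j =
      ∑ j ∈ Finset.range N, ∑ k ∈ Finset.range (N - j), F (j + k) j := by
  rw [Finset.sum_comm' (t' := Finset.range N) (s' := fun j => Finset.Ico j N)
    (fun n j => by simp only [Finset.mem_range, Finset.mem_Ico]; omega)]
  exact Finset.sum_congr rfl fun j _ => Finset.sum_Ico_eq_sum_range _ _ _

lemma seriesTendsTo_iff {u : ℕ → ℂ} {S : ℂ} :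
    SeriesTendsTo u S ↔
      Tendsto (fun N => ∑ n ∈ Finset.range N, u (n + 1)) atTop (𝓝 S) := by
  have h (N : ℕ) : ∑ n ∈ Finset.Icc 1 N, u n = ∑ n ∈ Finset.range N, u (n + 1) := by
    rw [Finset.range_eq_Ico, Finset.sum_Ico_add' u 0 N 1, zero_add, Finset.Ico_add_one_right_eq_Icc]
  simp only [SeriesTendsTo, h]

/-- The weight of `β_n` in the Bailey transform, for `n ≥ 1` (at `n = 0` the index `n - 1`
truncates to `0`). -/
noncomputable def baileyWeight (x p : ℂ) (n : ℕ) : ℂ :=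
  qPoch p p (n - 1) * (-1) ^ n * p ^ (n.choose 2) * x ^ n

/-- The terms of `₁φ₁(p^j; x p^(2j); p, x p^j)` divided by their sum. -/
noncomputable def normalizedPhiTerm (x p : ℂ) (j k : ℕ) : ℂ :=
  phiTerm p (p ^ j) (x * p ^ j) k / qPoch (x * p ^ j) p j

lemma add_choose_two (m k : ℕ) : (m + k).choose 2 = m.choose 2 + k.choose 2 + m * k := by
  induction k with
  | zero => simp
  | succ k ih =>
    rw [← add_assoc, choose_two_succ, choose_two_succ, ih]
    ring

lemma baileyWeight_add_div (hp : ‖p‖ < 1) (h : ∀ i, 1 - x * p ^ i ≠ 0) (j k : ℕ) :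
    baileyWeight x p (j + 1 + k) / (qPoch p p k * qPoch x p (j + 1 + k + (j + 1))) =
      baileyWeight x p (j + 1) / qPoch x p (j + 1) * normalizedPhiTerm x p (j + 1) k := by
  have hne := qPoch_ne_zero h (j + 1 + (j + 1) + k)
  have hp0 := qPoch_self_ne_zero hp k
  have hlen : j + 1 + k + (j + 1) = j + 1 + (j + 1) + k := by ring
  have hpow : p ^ (j + 1) * (x * p ^ (j + 1)) = x * p ^ (j + 1 + (j + 1)) := by ring
  have hpred : j + 1 + k - 1 = j + k := by omega
  rw [hlen]
  rw [qPoch_add, qPoch_add] at hne ⊢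
  simp only [baileyWeight, normalizedPhiTerm, phiTerm, hpow, hpred, Nat.add_sub_cancel]
  rw [qPoch_add p p j k, ← pow_succ', add_choose_two, mul_pow, pow_add p _ ((j + 1) * k),
    pow_add p _ (k.choose 2), pow_add x, pow_add (-1 : ℂ) (j + 1), pow_mul]
  have h1 := left_ne_zero_of_mul (left_ne_zero_of_mul hne)
  have h3 := right_ne_zero_of_mul hne
  field_simp

lemma hasSum_normalizedPhiTerm (hp : ‖p‖ < 1) (h : ∀ i, 1 - x * p ^ i ≠ 0) (j : ℕ) :
    HasSum (normalizedPhiTerm x p j) 1 := by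
  have hj (i : ℕ) : 1 - x * p ^ j * p ^ i ≠ 0 := one_sub_mul_pow_mul_pow_ne_zero h j i
  rw [← div_self (qPoch_ne_zero hj j)]
  exact (hasSum_phiTerm_pow hp (one_sub_mul_pow_mul_pow_ne_zero hj j)).div_const _

lemma exists_norm_normalizedPhiTerm_succ_le (hp : ‖p‖ < 1) (h : ∀ i, 1 - x * p ^ i ≠ 0) :
    ∃ C, ∀ j k, ‖normalizedPhiTerm x p (j + 1) (k + 1)‖ ≤
      ‖p‖ ^ (j + 1) * (‖p‖ ^ ((k + 1).choose 2) * ‖x‖ ^ (k + 1) * C) := by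
  obtain ⟨C, hC⟩ := exists_norm_qPoch_mul_pow_le hp (one_sub_mul_pow_ne_zero hp hp)
  obtain ⟨D, hD⟩ := exists_norm_qPoch_inv_le hp (one_sub_mul_pow_ne_zero hp hp)
  obtain ⟨E, hE⟩ := exists_norm_qPoch_mul_pow_inv_le hp h
  refine ⟨C * (D * E) * E, fun j k => ?_⟩
  have hphi := norm_phiTerm_mul_pow_succ_le (a := p ^ (j + 1)) (y := x) (n := j + 1) hp
    (fun k => by simpa only [pow_succ'] using hC j k) hD
    (fun k => by simpa only [mul_left_comm _ x, ← pow_add] using hE (j + 1 + (j + 1)) k) k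
  rw [normalizedPhiTerm, div_eq_mul_inv, norm_mul]
  calc _ ≤ ‖p‖ ^ (j + 1) * (‖p‖ ^ ((k + 1).choose 2) * ‖x‖ ^ (k + 1) * (C * (D * E))) * E :=
        mul_le_mul hphi (hE _ _) (norm_nonneg _) ((norm_nonneg _).trans hphi)
    _ = _ := by ring

lemma IsBaileyPair.baileyWeight_mul_succ {a : ℂ} {α β : ℕ → ℂ} (hαβ : IsBaileyPair a p α β)
    (hp : ‖p‖ < 1) (h : ∀ i, 1 - a * p * p ^ i ≠ 0) (n : ℕ) :
    baileyWeight (a * p) p (n + 1) * β (n + 1) =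
      (∑ j ∈ Finset.range (n + 1), α (j + 1) * (baileyWeight (a * p) p (n + 1) /
        (qPoch p p (n - j) * qPoch (a * p) p (n + 1 + (j + 1))))) +
      (-1) ^ (n + 1) * p ^ ((n + 1).choose 2) * (a * p) ^ (n + 1) /
        (qPoch (a * p) p (n + 1) * (1 - p ^ (n + 1))) := by
  obtain ⟨hα, -, hβ⟩ := hαβ
  have h1 := qPoch_ne_zero h (n + 1)
  have h2 := qPoch_self_ne_zero hp n
  have h3 := one_sub_pow_succ_ne_zero hp n
  rw [hβ _ n.succ_pos, Finset.sum_range_succ', mul_add, hα, Finset.mul_sum]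
  congr 1
  · refine Finset.sum_congr rfl fun j _ => ?_
    rw [Nat.succ_eq_add_one, Nat.add_sub_add_right]
    ring
  · rw [Nat.sub_zero, add_zero, qPoch_succ p p n, baileyWeight, ← pow_succ', Nat.add_sub_cancel]
    field_simp

theorem IsBaileyPair.seriesTendsTo {a A : ℂ} {α β : ℕ → ℂ} (hαβ : IsBaileyPair a p α β)
    (hp : ‖p‖ < 1) (h : ∀ i, 1 - a * p * p ^ i ≠ 0)
    (hA : SeriesTendsTo (fun n => baileyWeight (a * p) p n * α n / qPoch (a * p) p n) A) :
    SeriesTendsTo (fun n => baileyWeight (a * p) p n * β n) (A - lambertSeries (a * p) p) := by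
  rw [seriesTendsTo_iff] at hA ⊢
  obtain ⟨C, hC⟩ := exists_norm_normalizedPhiTerm_succ_le hp h
  have hb : Summable fun j : ℕ => ‖p‖ ^ (j + 1) :=
    (summable_nat_add_iff 1).mpr (summable_geometric_of_lt_one (norm_nonneg p) hp)
  have hg := (summable_pow_choose_two_mul_pow_succ (norm_nonneg p) hp ‖a * p‖).mul_right C
  have hmain := tendsto_sum_mul_sum_range_sub hA
    (fun j => hasSum_normalizedPhiTerm hp h (j + 1)) hb hg hC
  refine (hmain.add (hasSum_lambertSeries_alternating hp h).tendsto_sum_nat).congr fun N => ?_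
  simp only [hαβ.baileyWeight_mul_succ hp h, Finset.sum_add_distrib, sum_range_sum_range_succ,
    Nat.add_sub_cancel_left, add_right_comm _ _ 1, baileyWeight_add_div hp h, Finset.mul_sum]
  congr 1
  exact Finset.sum_congr rfl fun j _ => Finset.sum_congr rfl fun k _ => by ring

end BaileyTransform

section WellPoised

/-- The sequence `β_n` of the Bailey pair with respect to `a` with two free parameters `c`, `d`. -/
noncomputable def wellPoisedBeta (c d a p : ℂ) (n : ℕ) : ℂ :=
  qPoch (a * p / (c * d)) p n / (qPoch p p n * qPoch (a * p / c) p n * qPoch (a * p / d) p n)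

/-- The sequence `α_n` paired with `wellPoisedBeta`, without its very-well-poised factor
`1 - a p^(2n)`; splitting that factor off leaves a quotient of products with a first-order
recurrence. -/
noncomputable def wellPoisedTerm (c d a p : ℂ) (n : ℕ) : ℂ :=
  qPoch a p n * qPoch c p n * qPoch d p n * (-1) ^ n * p ^ (n.choose 2) * (a * p / (c * d)) ^ n /
    ((1 - a) * (qPoch p p n * qPoch (a * p / c) p n * qPoch (a * p / d) p n))

/-- The sequence `α_n` of the Bailey pair with respect to `a` with two free parameters `c`, `d`. -/
noncomputable def wellPoisedAlpha (c d a p : ℂ) (n : ℕ) : ℂ :=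
  (1 - a * p ^ (2 * n)) * wellPoisedTerm c d a p n

/-- The Wilf–Zeilberger certificate for the recurrence in `n` of
`∑ j, α_j / ((p; p)_(n-j) (a p; p)_(n+j))`, at the indices `(j + m, j)`. -/
noncomputable def wellPoisedCert (c d a p : ℂ) (j m : ℕ) : ℂ :=
  p ^ m * wellPoisedTerm c d a p j * (1 - p ^ j) * (1 - a / c * p ^ j) * (1 - a / d * p ^ j) /
    (qPoch p p m * qPoch (a * p) p (j + m - 1 + j))

variable {p a c d : ℂ}

lemma wellPoisedTerm_succ (hp : ‖p‖ < 1) (hac : ∀ j, 1 - a * p / c * p ^ j ≠ 0)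
    (had : ∀ j, 1 - a * p / d * p ^ j ≠ 0) (j : ℕ) :
    wellPoisedTerm c d a p (j + 1) *
        ((1 - p * p ^ j) * (1 - a * p / c * p ^ j) * (1 - a * p / d * p ^ j)) =
      -wellPoisedTerm c d a p j *
        ((1 - a * p ^ j) * (1 - c * p ^ j) * (1 - d * p ^ j) * p ^ j * (a * p / (c * d))) := by
  have hne := mul_ne_zero (mul_ne_zero (one_sub_mul_pow_ne_zero hp hp j) (hac j)) (had j)
  rw [← eq_div_iff hne, wellPoisedTerm, wellPoisedTerm]
  simp only [qPoch_succ, choose_two_succ, pow_add, pow_one, div_eq_mul_inv, mul_inv]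
  ring

lemma wellPoised_polynomial_identity (hc : c ≠ 0) (hd : d ≠ 0) (J M : ℂ) :
    (1 - a * J ^ 2) *
        ((1 - p * (J * M)) * (1 - a * p / c * (J * M)) * (1 - a * p / d * (J * M)) -
          (1 - a * p / (c * d) * (J * M)) * ((1 - p * M) * (1 - a * p * (J ^ 2 * M)))) =
      p * M * (1 - J) * (1 - a / c * J) * (1 - a / d * J) * (1 - a * p * (J ^ 2 * M)) +
        M * (1 - p * M) *
          ((1 - a * J) * (1 - c * J) * (1 - d * J) * J * (a * p / (c * d))) := by
  field_simp
  ring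

lemma wellPoisedCert_sub (hp : ‖p‖ < 1) (hc : c ≠ 0) (hd : d ≠ 0)
    (ha : ∀ j, 1 - a * p * p ^ j ≠ 0) (hac : ∀ j, 1 - a * p / c * p ^ j ≠ 0)
    (had : ∀ j, 1 - a * p / d * p ^ j ≠ 0) (j m : ℕ) :
    (1 - p * p ^ (j + m)) * (1 - a * p / c * p ^ (j + m)) * (1 - a * p / d * p ^ (j + m)) *
        (1 / (qPoch p p (m + 1) * qPoch (a * p) p (j + m + 1 + j)) * wellPoisedAlpha c d a p j) -
      (1 - a * p / (c * d) * p ^ (j + m)) *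
        (1 / (qPoch p p m * qPoch (a * p) p (j + m + j)) * wellPoisedAlpha c d a p j) =
      wellPoisedCert c d a p j (m + 1) - wellPoisedCert c d a p (j + 1) m := by
  have hterm := wellPoisedTerm_succ hp hac had j
  have hpoly := wellPoised_polynomial_identity (a := a) (p := p) hc hd (p ^ j) (p ^ m)
  have hshift (x : ℂ) : 1 - a / x * (p * p ^ j) = 1 - a * p / x * p ^ j := by ring
  have h2j : p ^ (j + m + j) = (p ^ j) ^ 2 * p ^ m := by ring
  have hlen : j + m + 1 + j = j + m + j + 1 := by ring
  have hlen' : j + 1 + m - 1 + (j + 1) = j + m + j + 1 := by omega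
  have h1 := qPoch_self_ne_zero hp m
  have h2 := qPoch_ne_zero ha (j + m + j)
  have h3 := one_sub_mul_pow_ne_zero hp hp m
  have h4 := ha (j + m + j)
  simp only [wellPoisedCert, wellPoisedAlpha, hlen, hlen', hshift, ← add_assoc,
    Nat.add_sub_cancel, qPoch_succ _ _ m, qPoch_succ _ _ (j + m + j), pow_succ' p j,
    pow_succ' p m, pow_mul' p 2 j, pow_add p j m]
  rw [h2j] at h4 ⊢
  generalize 1 - p * p ^ m = E at *
  generalize 1 - a * p * ((p ^ j) ^ 2 * p ^ m) = F at *
  generalize qPoch (a * p) p (j + m + j) = Q at *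
  generalize a * p / (c * d) = V at *
  generalize a * p / c = C at *
  generalize a * p / d = D at *
  generalize a / c = C' at *
  generalize a / d = D' at *
  field_simp
  linear_combination wellPoisedTerm c d a p j * hpoly + p ^ m * E * hterm

lemma wellPoisedCert_zero_left (m : ℕ) : wellPoisedCert c d a p 0 m = 0 := by
  simp [wellPoisedCert]

lemma wellPoisedCert_zero_right (ha : ∀ j, 1 - a * p * p ^ j ≠ 0) (n : ℕ) :
    wellPoisedCert c d a p (n + 1) 0 =
      (1 - p * p ^ n) * (1 - a * p / c * p ^ n) * (1 - a * p / d * p ^ n) *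
        (1 / (qPoch p p 0 * qPoch (a * p) p (n + 1 + (n + 1))) *
          wellPoisedAlpha c d a p (n + 1)) := by
  have h2 := ha (n + (n + 1))
  have hshift (x : ℂ) : 1 - a / x * p ^ (n + 1) = 1 - a * p / x * p ^ n := by ring
  have hpoised : 1 - a * p ^ (2 * (n + 1)) = 1 - a * p * p ^ (n + (n + 1)) := by ring
  have hlen : n + 1 + (n + 1) = n + (n + 1) + 1 := by ring
  rw [wellPoisedCert, wellPoisedAlpha, hlen, qPoch_succ _ _ (n + (n + 1)), hshift, hshift, hpoised,
    Nat.add_zero, Nat.add_sub_cancel, pow_zero, pow_succ' p n, one_div_mul_eq_div, ← mul_assoc,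
    mul_comm (1 - a * p * p ^ (n + (n + 1))), mul_div_mul_right _ _ h2]
  ring

lemma sum_wellPoisedAlpha_succ (hp : ‖p‖ < 1) (hc : c ≠ 0) (hd : d ≠ 0)
    (ha : ∀ j, 1 - a * p * p ^ j ≠ 0) (hac : ∀ j, 1 - a * p / c * p ^ j ≠ 0)
    (had : ∀ j, 1 - a * p / d * p ^ j ≠ 0) (n : ℕ) :
    (1 - p * p ^ n) * (1 - a * p / c * p ^ n) * (1 - a * p / d * p ^ n) *
        ∑ j ∈ Finset.range (n + 2),
          1 / (qPoch p p (n + 1 - j) * qPoch (a * p) p (n + 1 + j)) * wellPoisedAlpha c d a p j =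
      (1 - a * p / (c * d) * p ^ n) *
        ∑ j ∈ Finset.range (n + 1),
          1 / (qPoch p p (n - j) * qPoch (a * p) p (n + j)) * wellPoisedAlpha c d a p j := by
  have htelescope := Finset.sum_range_sub' (fun j => wellPoisedCert c d a p j (n + 1 - j)) (n + 1)
  rw [wellPoisedCert_zero_left, zero_sub, Nat.sub_self, wellPoisedCert_zero_right ha] at htelescope
  rw [Finset.sum_range_succ, Nat.sub_self, mul_add, ← neg_eq_iff_eq_neg.mpr htelescope,
    add_neg_eq_iff_eq_add, Finset.mul_sum, Finset.mul_sum, ← Finset.sum_add_distrib]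
  refine Finset.sum_congr rfl fun j hj => ?_
  obtain ⟨m, rfl⟩ := Nat.exists_eq_add_of_le (Nat.lt_succ_iff.mp (Finset.mem_range.mp hj))
  have hcert := wellPoisedCert_sub hp hc hd ha hac had j m
  have hlen : j + m + 1 - j = m + 1 := by omega
  rw [hlen, Nat.add_sub_add_right, Nat.add_sub_cancel_left]
  linear_combination hcert

lemma wellPoisedBeta_succ (hp : ‖p‖ < 1) (hac : ∀ j, 1 - a * p / c * p ^ j ≠ 0)
    (had : ∀ j, 1 - a * p / d * p ^ j ≠ 0) (n : ℕ) :
    (1 - p * p ^ n) * (1 - a * p / c * p ^ n) * (1 - a * p / d * p ^ n) *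
        wellPoisedBeta c d a p (n + 1) =
      (1 - a * p / (c * d) * p ^ n) * wellPoisedBeta c d a p n := by
  have hne := mul_ne_zero (mul_ne_zero (one_sub_mul_pow_ne_zero hp hp n) (hac n)) (had n)
  rw [mul_comm, ← eq_div_iff hne, wellPoisedBeta, wellPoisedBeta]
  simp only [qPoch_succ, div_eq_mul_inv, mul_inv]
  ring

theorem isBaileyPair_wellPoised (hp : ‖p‖ < 1) (hc : c ≠ 0) (hd : d ≠ 0)
    (ha : ∀ j, 1 - a * p ^ j ≠ 0) (hac : ∀ j, 1 - a * p / c * p ^ j ≠ 0)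
    (had : ∀ j, 1 - a * p / d * p ^ j ≠ 0) :
    IsBaileyPair a p (wellPoisedAlpha c d a p) (wellPoisedBeta c d a p) := by
  have ha0 : 1 - a ≠ 0 := by simpa using ha 0
  have ha1 (j : ℕ) : 1 - a * p * p ^ j ≠ 0 := by simpa only [mul_assoc, pow_succ'] using ha (j + 1)
  have hα : wellPoisedAlpha c d a p 0 = 1 := by
    simp [wellPoisedAlpha, wellPoisedTerm, qPoch_zero, ha0]
  have hβ : wellPoisedBeta c d a p 0 = 1 := by simp [wellPoisedBeta, qPoch_zero]
  suffices hsum : ∀ n, wellPoisedBeta c d a p n = ∑ j ∈ Finset.range (n + 1),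
      1 / (qPoch p p (n - j) * qPoch (a * p) p (n + j)) * wellPoisedAlpha c d a p j from
    ⟨hα, hβ, fun n _ => hsum n⟩
  intro n
  induction n with
  | zero => simp [hα, hβ, qPoch_zero]
  | succ n ih =>
    have hne := mul_ne_zero (mul_ne_zero (one_sub_mul_pow_ne_zero hp hp n) (hac n)) (had n)
    refine mul_left_cancel₀ hne ?_
    rw [sum_wellPoisedAlpha_succ hp hc hd ha1 hac had, ← ih, wellPoisedBeta_succ hp hac had]

lemma summable_norm_pow_choose_two_mul_pow_succ (hp : ‖p‖ < 1) (x : ℂ) :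
    Summable fun n => ‖p ^ ((n + 1).choose 2) * x ^ (n + 1)‖ := by
  simpa only [norm_mul, norm_pow] using
    summable_pow_choose_two_mul_pow_succ (norm_nonneg p) hp ‖x‖

lemma summable_baileyWeight_mul_wellPoisedBeta (hp : ‖p‖ < 1) (x : ℂ)
    (hac : ∀ j, 1 - a * p / c * p ^ j ≠ 0) (had : ∀ j, 1 - a * p / d * p ^ j ≠ 0) :
    Summable fun n => baileyWeight x p (n + 1) * wellPoisedBeta c d a p (n + 1) := by
  have hp1 := one_sub_mul_pow_ne_zero hp hp
  have hlim := ((tendsto_qPoch hp (a * p / (c * d))).div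
    (((tendsto_qPoch hp p).mul (tendsto_qPoch hp (a * p / c))).mul (tendsto_qPoch hp (a * p / d)))
    (mul_ne_zero (mul_ne_zero (qPochInf_ne_zero hp hp1) (qPochInf_ne_zero hp hac))
      (qPochInf_ne_zero hp had))).comp (tendsto_add_atTop_nat 1)
  refine (Summable.mul_tendsto_const (summable_norm_pow_choose_two_mul_pow_succ hp (-x))
    (Nat.cofinite_eq_atTop ▸ (tendsto_qPoch hp p).mul hlim)).congr fun n => ?_
  simp only [baileyWeight, wellPoisedBeta, Function.comp_apply, Nat.add_sub_cancel, neg_pow x,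
    Pi.div_apply]
  ring

lemma baileyWeight_mul_wellPoisedAlpha (n : ℕ) :
    baileyWeight (a * p) p n * wellPoisedAlpha c d a p n / qPoch (a * p) p n =
      (1 - a * p ^ (2 * n)) * qPoch p p (n - 1) * (qPoch a p n * qPoch c p n * qPoch d p n) *
        (p ^ (n.choose 2) * (a * p) ^ n) ^ 2 /
      ((1 - a) * (qPoch (a * p / c) p n * qPoch (a * p / d) p n * qPoch (a * p) p n *
        qPoch p p n) * c ^ n * d ^ n) := by
  have hsign : (-1 : ℂ) ^ n * (-1) ^ n = 1 := by rw [← mul_pow, neg_one_mul, neg_neg, one_pow]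
  rw [baileyWeight, wellPoisedAlpha, wellPoisedTerm, div_pow, mul_pow c d]
  simp only [div_eq_mul_inv, mul_inv]
  linear_combination (1 - a * p ^ (2 * n)) * qPoch p p (n - 1) *
    (qPoch a p n * qPoch c p n * qPoch d p n) * (p ^ (n.choose 2) * (a * p) ^ n) ^ 2 *
    ((1 - a)⁻¹ * ((qPoch (a * p * c⁻¹) p n)⁻¹ * (qPoch (a * p * d⁻¹) p n)⁻¹ *
      (qPoch (a * p) p n)⁻¹ * (qPoch p p n)⁻¹) * (c ^ n)⁻¹ * (d ^ n)⁻¹) * hsign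

lemma summable_baileyWeight_mul_wellPoisedAlpha (hp : ‖p‖ < 1)
    (ha : ∀ j, 1 - a * p * p ^ j ≠ 0) (hac : ∀ j, 1 - a * p / c * p ^ j ≠ 0)
    (had : ∀ j, 1 - a * p / d * p ^ j ≠ 0) :
    Summable fun n => baileyWeight (a * p) p (n + 1) * wellPoisedAlpha c d a p (n + 1) /
      qPoch (a * p) p (n + 1) := by
  have hp2 : ‖p ^ 2‖ < 1 := norm_pow_lt_one hp two_ne_zero
  have hpoised : Tendsto (fun n => 1 - a * (p ^ 2) ^ n) atTop (𝓝 (1 - a * 0)) :=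
    ((tendsto_pow_atTop_nhds_zero_of_norm_lt_one hp2).const_mul a).const_sub 1
  have hlim := ((hpoised.mul (((tendsto_qPoch hp a).mul (tendsto_qPoch hp c)).mul
    (tendsto_qPoch hp d))).div
    ((((tendsto_qPoch hp (a * p / c)).mul (tendsto_qPoch hp (a * p / d))).mul
      (tendsto_qPoch hp (a * p))).mul (tendsto_qPoch hp p))
    (mul_ne_zero (mul_ne_zero (mul_ne_zero (qPochInf_ne_zero hp hac) (qPochInf_ne_zero hp had))
      (qPochInf_ne_zero hp ha))
      (qPochInf_ne_zero hp (one_sub_mul_pow_ne_zero hp hp)))).comp (tendsto_add_atTop_nat 1)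
  refine ((Summable.mul_tendsto_const
    (summable_norm_pow_choose_two_mul_pow_succ hp2 ((a * p) ^ 2 / (c * d)))
    (Nat.cofinite_eq_atTop ▸ (tendsto_qPoch hp p).mul hlim)).mul_left (1 - a)⁻¹).congr fun n => ?_
  rw [baileyWeight_mul_wellPoisedAlpha, Function.comp_apply, Pi.div_apply, Nat.add_sub_cancel]
  simp only [pow_mul, div_eq_mul_inv, mul_inv]
  ring

theorem exists_hasSum_wellPoised (hp : ‖p‖ < 1) (hc : c ≠ 0) (hd : d ≠ 0)
    (ha : ∀ j, 1 - a * p ^ j ≠ 0) (hac : ∀ j, 1 - a * p / c * p ^ j ≠ 0)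
    (had : ∀ j, 1 - a * p / d * p ^ j ≠ 0) :
    ∃ A B : ℂ,
      HasSum (fun n : ℕ+ => baileyWeight (a * p) p n * wellPoisedBeta c d a p n) B ∧
      HasSum (fun n : ℕ+ =>
        baileyWeight (a * p) p n * wellPoisedAlpha c d a p n / qPoch (a * p) p n) A ∧
      B = A - lambertSeries (a * p) p := by
  have ha1 (j : ℕ) : 1 - a * p * p ^ j ≠ 0 := by simpa only [mul_assoc, pow_succ'] using ha (j + 1)
  obtain ⟨A, hA⟩ := summable_baileyWeight_mul_wellPoisedAlpha hp ha1 hac had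
  obtain ⟨B, hB⟩ := summable_baileyWeight_mul_wellPoisedBeta hp (a * p) hac had
  refine ⟨A, B, (hasSum_pnat_iff_hasSum_succ (f := fun n =>
      baileyWeight (a * p) p n * wellPoisedBeta c d a p n)).mpr hB,
    (hasSum_pnat_iff_hasSum_succ (f := fun n =>
      baileyWeight (a * p) p n * wellPoisedAlpha c d a p n / qPoch (a * p) p n)).mpr hA, ?_⟩
  have htransform := (isBaileyPair_wellPoised hp hc hd ha hac had).seriesTendsTo hp ha1
    (seriesTendsTo_iff.mpr hA.tendsto_sum_nat)
  exact tendsto_nhds_unique hB.tendsto_sum_nat (seriesTendsTo_iff.mp htransform)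

end WellPoised

section JacobiTripleProduct

/-- The binomial coefficient `k (k - 1) / 2` of an integer `k`. -/
def intChooseTwo (k : ℤ) : ℤ := k * (k - 1) / 2

lemma two_mul_intChooseTwo (k : ℤ) : 2 * intChooseTwo k = k * (k - 1) :=
  Int.mul_ediv_cancel' (Int.even_mul_pred_self k).two_dvd

lemma intChooseTwo_add (i m : ℤ) :
    intChooseTwo (i + m) = intChooseTwo i + intChooseTwo m + i * m := by
  linarith [two_mul_intChooseTwo (i + m), two_mul_intChooseTwo i, two_mul_intChooseTwo m]

lemma intChooseTwo_natCast (n : ℕ) : intChooseTwo n = n.choose 2 := by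
  cases n <;> simp [intChooseTwo, Nat.choose_two_right]

lemma intChooseTwo_neg_natCast (n : ℕ) : intChooseTwo (-n) = n.choose 2 + n := by
  have h := two_mul_intChooseTwo n
  rw [intChooseTwo_natCast] at h
  linarith [two_mul_intChooseTwo (-n)]

/-- The general term of the theta series `∑ k : ℤ, (-1)^k q^(k(k-1)/2) z^k`, for `q, z ≠ 0`. -/
noncomputable def thetaTerm (q z : ℂ) (k : ℤ) : ℂ :=
  (-1) ^ k * q ^ intChooseTwo k * z ^ k

/-- The theta series `∑ k : ℤ, (-1)^k q^(k(k-1)/2) z^k`, for `0 < ‖q‖ < 1` and `z ≠ 0`. -/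
noncomputable def theta (q z : ℂ) : ℂ :=
  ∑' k, thetaTerm q z k

/-- `1 / (q; q)_m`, extended by zero to negative `m`, as its recurrence in `m` demands. -/
noncomputable def qPochSelfInv (q : ℂ) (m : ℤ) : ℂ :=
  if 0 ≤ m then (qPoch q q m.toNat)⁻¹ else 0

/-- The general term of the finite form of the Jacobi triple product, which expands
`(z; q)_M (q / z; q)_N`. -/
noncomputable def finiteThetaTerm (q z : ℂ) (M N : ℕ) (k : ℤ) : ℂ :=
  qPoch q q (M + N) * qPochSelfInv q (N + k) * qPochSelfInv q (M - k) * thetaTerm q z k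

variable {q z : ℂ}

lemma thetaTerm_zero (q z : ℂ) : thetaTerm q z 0 = 1 := by
  simp [thetaTerm, intChooseTwo]

lemma thetaTerm_add_one (hq0 : q ≠ 0) (hz : z ≠ 0) (k : ℤ) :
    thetaTerm q z (k + 1) = -(z * q ^ k * thetaTerm q z k) := by
  have hone : intChooseTwo 1 = 0 := by decide
  rw [thetaTerm, thetaTerm, intChooseTwo_add, hone, zpow_add₀ hq0, zpow_add₀ hq0, zpow_add₀ hz,
    zpow_add₀ (neg_ne_zero.mpr one_ne_zero)]
  simp only [zpow_one, zpow_zero, mul_one]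
  ring

lemma summable_norm_thetaTerm (hq0 : q ≠ 0) (hq : ‖q‖ < 1) (z : ℂ) :
    Summable fun k => ‖thetaTerm q z k‖ := by
  refine .of_nat_of_neg ?_ ?_
  · refine (summable_pow_choose_two_mul_pow (norm_nonneg q) hq ‖z‖).congr fun n => ?_
    simp [thetaTerm, intChooseTwo_natCast]
  · refine (summable_pow_choose_two_mul_pow (norm_nonneg q) hq (‖q‖ * ‖z‖⁻¹)).congr fun n => ?_
    simp [thetaTerm, intChooseTwo_neg_natCast, zpow_add₀ (norm_ne_zero_iff.mpr hq0), mul_pow,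
      mul_assoc]

lemma qPochSelfInv_natCast (q : ℂ) (n : ℕ) : qPochSelfInv q n = (qPoch q q n)⁻¹ := by
  simp [qPochSelfInv]

lemma qPochSelfInv_of_neg (q : ℂ) {m : ℤ} (hm : m < 0) : qPochSelfInv q m = 0 :=
  if_neg hm.not_ge

lemma qPochSelfInv_sub_one (hq : ‖q‖ < 1) (m : ℤ) :
    qPochSelfInv q (m - 1) = (1 - q ^ m) * qPochSelfInv q m := by
  rcases lt_trichotomy m 0 with hm | rfl | hm
  · rw [qPochSelfInv_of_neg q hm, qPochSelfInv_of_neg q (by omega), mul_zero]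
  · rw [qPochSelfInv_of_neg q (by omega), zpow_zero, sub_self, zero_mul]
  · obtain ⟨n, rfl⟩ : ∃ n : ℕ, m = n + 1 := ⟨(m - 1).toNat, by omega⟩
    have hn := one_sub_pow_succ_ne_zero hq n
    rw [add_sub_cancel_right]
    norm_cast
    rw [qPochSelfInv_natCast, qPochSelfInv_natCast, qPoch_succ, ← pow_succ', mul_inv,
      mul_left_comm, mul_inv_cancel₀ hn, mul_one]

lemma exists_norm_qPochSelfInv_le (hq : ‖q‖ < 1) : ∃ C, ∀ m, ‖qPochSelfInv q m‖ ≤ C := by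
  obtain ⟨C, hC⟩ := exists_norm_qPoch_inv_le hq (one_sub_mul_pow_ne_zero hq hq)
  refine ⟨C, fun m => ?_⟩
  rcases lt_or_ge m 0 with hm | hm
  · simpa only [qPochSelfInv_of_neg q hm, norm_zero] using (norm_nonneg _).trans (hC 0)
  · simpa only [qPochSelfInv, if_pos hm] using hC _

lemma tendsto_qPochSelfInv (hq : ‖q‖ < 1) :
    Tendsto (qPochSelfInv q) atTop (𝓝 (qPochInf q q)⁻¹) := by
  have hlim := (tendsto_qPoch hq q).inv₀ (qPochInf_ne_zero hq (one_sub_mul_pow_ne_zero hq hq))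
  have htoNat : Tendsto Int.toNat atTop atTop :=
    tendsto_atTop.mpr fun n => (eventually_ge_atTop (n : ℤ)).mono fun m hm => by omega
  refine (hlim.comp htoNat).congr' ?_
  filter_upwards [eventually_ge_atTop 0] with m hm
  exact (if_pos hm).symm

lemma finiteThetaTerm_succ_left (hq0 : q ≠ 0) (hq : ‖q‖ < 1) (hz : z ≠ 0) (M N : ℕ) (k : ℤ) :
    finiteThetaTerm q z (M + 1) N k =
      finiteThetaTerm q z M N k - z * q ^ M * finiteThetaTerm q z M N (k - 1) := by
  have hθ := thetaTerm_add_one hq0 hz (k - 1)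
  have hN := qPochSelfInv_sub_one hq (N + k)
  have hM := qPochSelfInv_sub_one hq (M + 1 - k)
  have h1 : (M + 1 - k - 1 : ℤ) = M - k := by ring
  have h2 : (M - (k - 1) : ℤ) = M + 1 - k := by ring
  rw [sub_add_cancel] at hθ
  rw [h1] at hM
  have hpow : q ^ (M + 1 - k : ℤ) * q ^ (k - 1) = q ^ M := by
    rw [← zpow_add₀ hq0, ← zpow_natCast]; congr 1; ring
  have hpow' : q ^ (M + 1 - k : ℤ) * q ^ (N + k : ℤ) = q * q ^ (M + N) := by
    rw [← zpow_add₀ hq0, ← pow_succ', ← zpow_natCast]; congr 1; push_cast; ring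
  simp only [finiteThetaTerm, h2, Nat.cast_add_one, ← add_sub_assoc, hN, hM, add_right_comm M 1 N,
    qPoch_succ, ← hpow', ← hpow]
  rw [hθ]
  ring

lemma finiteThetaTerm_succ_right (hq0 : q ≠ 0) (hq : ‖q‖ < 1) (hz : z ≠ 0) (M N : ℕ) (k : ℤ) :
    finiteThetaTerm q z M (N + 1) k =
      finiteThetaTerm q z M N k - q / z * q ^ N * finiteThetaTerm q z M N (k + 1) := by
  have hN := qPochSelfInv_sub_one hq (N + 1 + k)
  have hM := qPochSelfInv_sub_one hq (M - k)
  have h1 : (N + 1 + k - 1 : ℤ) = N + k := by ring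
  have h2 : (N + (k + 1) : ℤ) = N + 1 + k := by ring
  have h3 : (M - (k + 1) : ℤ) = M - k - 1 := by ring
  rw [h1] at hN
  have hpow : q * q ^ N * q ^ k = q ^ (N + 1 + k : ℤ) := by
    rw [zpow_add₀ hq0, zpow_add₀ hq0, zpow_one, zpow_natCast]; ring
  have hpow' : q ^ (N + 1 + k : ℤ) * q ^ (M - k : ℤ) = q * q ^ (M + N) := by
    rw [← zpow_add₀ hq0, ← pow_succ', ← zpow_natCast]; congr 1; push_cast; ring
  have hcancel : q / z * q ^ N * (z * q ^ k) = q ^ (N + 1 + k : ℤ) := by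
    rw [← hpow]; field_simp
  simp only [finiteThetaTerm, h2, h3, Nat.cast_add_one, hN, hM, ← add_assoc, qPoch_succ, ← hpow',
    thetaTerm_add_one hq0 hz]
  linear_combination (-qPoch q q (M + N) * qPochSelfInv q (N + 1 + k) * (1 - q ^ (M - k : ℤ)) *
    qPochSelfInv q (M - k) * thetaTerm q z k) * hcancel

lemma hasSum_finiteThetaTerm (hq0 : q ≠ 0) (hq : ‖q‖ < 1) (hz : z ≠ 0) (M N : ℕ) :
    HasSum (finiteThetaTerm q z M N) (qPoch z q M * qPoch (q / z) q N) := by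
  induction M with
  | zero =>
    induction N with
    | zero =>
      have h0 (k : ℤ) (hk : k ≠ 0) : finiteThetaTerm q z 0 0 k = 0 := by
        rcases hk.lt_or_gt with hk | hk
        · simp [finiteThetaTerm, qPochSelfInv_of_neg q hk]
        · simp [finiteThetaTerm, qPochSelfInv_of_neg q (neg_neg_of_pos hk)]
      simpa [finiteThetaTerm, thetaTerm_zero, qPochSelfInv, qPoch_zero] using hasSum_single 0 h0
    | succ N ih =>
      have hshift := ((Equiv.addRight (1 : ℤ)).hasSum_iff).mpr ih
      have h := ih.sub (hshift.mul_left (q / z * q ^ N))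
      rw [← one_sub_mul, mul_left_comm, mul_comm (1 - _), ← qPoch_succ] at h
      exact h.congr_fun fun k => finiteThetaTerm_succ_right hq0 hq hz 0 N k
  | succ M ih =>
    have hshift := ((Equiv.subRight (1 : ℤ)).hasSum_iff).mpr ih
    have h := ih.sub (hshift.mul_left (z * q ^ M))
    rw [← one_sub_mul, ← mul_assoc, mul_comm (1 - _), ← qPoch_succ] at h
    exact h.congr_fun fun k => finiteThetaTerm_succ_left hq0 hq hz M N k

lemma tendsto_finiteThetaTerm (hq : ‖q‖ < 1) (z : ℂ) (k : ℤ) :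
    Tendsto (fun N : ℕ => finiteThetaTerm q z N N k) atTop
      (𝓝 ((qPochInf q q)⁻¹ * thetaTerm q z k)) := by
  have hE := qPochInf_ne_zero hq (one_sub_mul_pow_ne_zero hq hq)
  have hN : Tendsto (fun N : ℕ => (N : ℤ)) atTop atTop := tendsto_natCast_atTop_atTop
  have h1 := (tendsto_qPoch hq q).comp (tendsto_id.atTop_add_nonneg fun N : ℕ => N.zero_le)
  have h2 := (tendsto_qPochSelfInv hq).comp (tendsto_atTop_add_const_right _ k hN)
  have h3 := (tendsto_qPochSelfInv hq).comp (tendsto_atTop_add_const_right _ (-k) hN)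
  have h := ((h1.mul h2).mul h3).mul_const (thetaTerm q z k)
  rwa [mul_inv_cancel₀ hE, one_mul] at h

theorem jacobi_triple_product (hq0 : q ≠ 0) (hq : ‖q‖ < 1) (hz : z ≠ 0) :
    theta q z = qPochInf q q * (qPochInf z q * qPochInf (q / z) q) := by
  have hE := qPochInf_ne_zero hq (one_sub_mul_pow_ne_zero hq hq)
  obtain ⟨C, hC⟩ := exists_norm_qPoch_le hq q
  obtain ⟨D, hD⟩ := exists_norm_qPochSelfInv_le hq
  have hC0 := (norm_nonneg _).trans (hC 0)
  have hD0 := (norm_nonneg _).trans (hD 0)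
  have hbound (N : ℕ) (k : ℤ) : ‖finiteThetaTerm q z N N k‖ ≤ C * D * D * ‖thetaTerm q z k‖ := by
    rw [finiteThetaTerm, norm_mul, norm_mul, norm_mul]
    gcongr <;> apply_assumption
  have hlim := tendsto_tsum_of_dominated_convergence
    ((summable_norm_thetaTerm hq0 hq z).mul_left (C * D * D)) (tendsto_finiteThetaTerm hq z)
    (.of_forall hbound)
  simp only [(hasSum_finiteThetaTerm hq0 hq hz _ _).tsum_eq, tsum_mul_left] at hlim
  have hprod := (tendsto_qPoch hq z).mul (tendsto_qPoch hq (q / z))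
  rw [← tendsto_nhds_unique hlim hprod, mul_inv_cancel_left₀ hE, theta]

end JacobiTripleProduct

section RootsOfUnity

lemma sum_pow_zpow_of_isPrimitiveRoot {K : Type*} [Field K] {ζ : K} {k : ℕ}
    (hζ : IsPrimitiveRoot ζ k) (s : ℤ) :
    ∑ i ∈ Finset.range k, (ζ ^ i) ^ s = if (k : ℤ) ∣ s then (k : K) else 0 := by
  have hcomm (i : ℕ) : (ζ ^ i) ^ s = (ζ ^ s) ^ i := by
    rw [← zpow_natCast, ← zpow_natCast, zpow_comm]
  split_ifs with hs
  · simp [hcomm, (hζ.zpow_eq_one_iff_dvd s).mpr hs]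
  · have hpow : (ζ ^ s) ^ k = 1 := by rw [← hcomm, hζ.pow_eq_one, one_zpow]
    simp only [hcomm]
    rw [geom_sum_eq (mt (hζ.zpow_eq_one_iff_dvd s).mp hs), hpow, sub_self, zero_div]

lemma prod_one_sub_pow_mul_of_isPrimitiveRoot {R : Type*} [CommRing R] [IsDomain R] {ζ : R}
    {k : ℕ} (hk : 0 < k) (hζ : IsPrimitiveRoot ζ k) (x : R) :
    ∏ i ∈ Finset.range k, (1 - ζ ^ i * x) = 1 - x ^ k := by
  classical
  have h := hζ.pow_sub_pow_eq_prod_sub_mul 1 x hk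
  rw [one_pow, Polynomial.nthRootsFinset_def, ← Multiset.toFinset_eq hζ.nthRoots_one_nodup] at h
  simpa [Finset.prod, hζ.nthRoots_eq (one_pow k)] using h.symm

variable {p ζ : ℂ} {k : ℕ}

lemma prod_qPochInf_pow_mul_of_isPrimitiveRoot (hk : 0 < k) (hζ : IsPrimitiveRoot ζ k)
    (hp : ‖p‖ < 1) (x : ℂ) :
    ∏ i ∈ Finset.range k, qPochInf (ζ ^ i * x) p = qPochInf (x ^ k) (p ^ k) := by
  have hpk : ‖p ^ k‖ < 1 := norm_pow_lt_one hp hk.ne'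
  refine tendsto_nhds_unique (tendsto_finsetProd _ fun i _ => tendsto_qPoch hp (ζ ^ i * x))
    ((tendsto_qPoch hpk (x ^ k)).congr fun n => ?_)
  simp only [qPoch]
  rw [Finset.prod_comm]
  refine Finset.prod_congr rfl fun j _ => ?_
  simp only [mul_assoc, prod_one_sub_pow_mul_of_isPrimitiveRoot hk hζ]
  ring

end RootsOfUnity

section CubicThetaTrisection

variable {q z ζ : ℂ}

lemma summable_pow_natAbs {r : ℝ} (hr : 0 ≤ r) (hr1 : r < 1) :
    Summable fun k : ℤ => r ^ k.natAbs := by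
  refine .of_nat_of_neg ?_ ?_ <;> simpa using summable_geometric_of_lt_one hr hr1

lemma natAbs_add_natAbs_le {m n : ℤ} {e : ℕ} (he : m ^ 2 + m * n + n ^ 2 = e) :
    m.natAbs + n.natAbs ≤ 2 * e := by
  have hm : m.natAbs ≤ m.natAbs ^ 2 := Nat.le_self_pow two_ne_zero _
  have hn : n.natAbs ≤ n.natAbs ^ 2 := Nat.le_self_pow two_ne_zero _
  zify at hm hn ⊢
  rw [sq_abs] at hm hn
  nlinarith [sq_nonneg (m + n)]

lemma summable_norm_cubicTheta (hq : ‖q‖ < 1) :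
    Summable fun p : ℤ × ℤ => ‖q ^ (p.1 ^ 2 + p.1 * p.2 + p.2 ^ 2)‖ := by
  have hr0 := Real.sqrt_nonneg ‖q‖
  have hr1 : √‖q‖ < 1 := (Real.sqrt_lt' one_pos).mpr (by simpa using hq)
  have hs := summable_pow_natAbs hr0 hr1
  refine .of_nonneg_of_le (fun _ => norm_nonneg _) (fun ⟨m, n⟩ => ?_)
    (hs.mul_of_nonneg hs (fun _ => by positivity) (fun _ => by positivity))
  have hnonneg : 0 ≤ m ^ 2 + m * n + n ^ 2 := by
    nlinarith [sq_nonneg (m + n), sq_nonneg m, sq_nonneg n]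
  obtain ⟨e, he⟩ := Int.eq_ofNat_of_zero_le hnonneg
  calc ‖q ^ (m ^ 2 + m * n + n ^ 2)‖ = √‖q‖ ^ (2 * e) := by
        rw [he, zpow_natCast, norm_pow, pow_mul, Real.sq_sqrt (norm_nonneg q)]
    _ ≤ √‖q‖ ^ (m.natAbs + n.natAbs) :=
        pow_le_pow_of_le_one hr0 hr1.le (natAbs_add_natAbs_le he)
    _ = √‖q‖ ^ m.natAbs * √‖q‖ ^ n.natAbs := pow_add ..

lemma cubicTheta_zero : cubicTheta 0 = 1 := by
  rw [cubicTheta, tsum_eq_single (0, 0)]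
  · simp
  · rintro ⟨m, n⟩ hmn
    refine zero_zpow _ fun h => hmn ?_
    dsimp only at h
    have hm : m = 0 := by nlinarith [sq_nonneg (m + 2 * n), sq_nonneg m]
    simpa [hm] using h

lemma thetaTerm_mul (q w z : ℂ) (k : ℤ) : thetaTerm q (w * z) k = w ^ k * thetaTerm q z k := by
  rw [thetaTerm, thetaTerm, mul_zpow]
  ring

lemma hasSum_thetaTerm_pow_three (hq0 : q ≠ 0) (hq : ‖q‖ < 1) {w : ℂ} (hw : w ≠ 0) (z : ℂ) :
    HasSum (fun x : ℤ × ℤ × ℤ => w ^ (x.1 + (x.2.1 + x.2.2)) *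
      (thetaTerm q z x.1 * (thetaTerm q z x.2.1 * thetaTerm q z x.2.2))) (theta q (w * z) ^ 3) := by
  have h1 := summable_norm_thetaTerm hq0 hq (w * z)
  have h2 := h1.mul_norm h1
  have h3 := (summable_mul_of_summable_norm h1 h2).hasSum
  rw [← tsum_mul_tsum_of_summable_norm h1 h2, ← tsum_mul_tsum_of_summable_norm h1 h1, ← theta,
    ← pow_two, ← pow_succ'] at h3
  refine h3.congr_fun fun x => ?_
  simp only [thetaTerm_mul, zpow_add₀ hw]
  ring

lemma thetaTerm_mul_thetaTerm_mul_thetaTerm (hq0 : q ≠ 0) (hz : z ≠ 0) (i j m : ℤ) :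
    thetaTerm q z (i + m) * (thetaTerm q z (j + m) * thetaTerm q z (m - i - j)) =
      q ^ (i ^ 2 + i * j + j ^ 2) * thetaTerm (q ^ 3) (z ^ 3) m := by
  have hexp : intChooseTwo (i + m) + (intChooseTwo (j + m) + intChooseTwo (m - i - j)) =
      (i ^ 2 + i * j + j ^ 2) + intChooseTwo m * 3 := by
    linarith [two_mul_intChooseTwo (i + m), two_mul_intChooseTwo (j + m),
      two_mul_intChooseTwo (m - i - j), two_mul_intChooseTwo m]
  have hlin : i + m + (j + m + (m - i - j)) = m * 3 := by ring
  have hneg : (-1 : ℂ) ≠ 0 := neg_ne_zero.mpr one_ne_zero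
  calc _ = (-1 : ℂ) ^ (i + m + (j + m + (m - i - j))) *
        q ^ (intChooseTwo (i + m) + (intChooseTwo (j + m) + intChooseTwo (m - i - j))) *
        z ^ (i + m + (j + m + (m - i - j))) := by
        simp only [thetaTerm, zpow_add₀ hneg, zpow_add₀ hq0, zpow_add₀ hz]
        ring
    _ = q ^ (i ^ 2 + i * j + j ^ 2) * thetaTerm (q ^ 3) (z ^ 3) m := by
        have hsign : (-1 : ℂ) ^ (m * 3) = (-1) ^ m := by
          rw [mul_comm, zpow_mul]; norm_num
        rw [hexp, hlin, hsign, zpow_add₀ hq0, mul_comm _ 3, mul_comm m, zpow_mul, zpow_mul,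
          thetaTerm]
        norm_cast
        ring

theorem sum_theta_pow_three (hζ : IsPrimitiveRoot ζ 3) (hq0 : q ≠ 0) (hq : ‖q‖ < 1)
    (hz : z ≠ 0) :
    ∑ i ∈ Finset.range 3, theta q (ζ ^ i * z) ^ 3 =
      3 * cubicTheta q * theta (q ^ 3) (z ^ 3) := by
  have hζ0 := hζ.ne_zero three_ne_zero
  have hq3 : ‖q ^ 3‖ < 1 := norm_pow_lt_one hq three_ne_zero
  have hsum := hasSum_sum fun i (_ : i ∈ Finset.range 3) =>
    hasSum_thetaTerm_pow_three hq0 hq (pow_ne_zero i hζ0) z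
  simp only [← Finset.sum_mul, sum_pow_zpow_of_isPrimitiveRoot hζ] at hsum
  have hinj : Function.Injective fun y : (ℤ × ℤ) × ℤ =>
      ((y.1.1 + y.2, y.1.2 + y.2, y.2 - y.1.1 - y.1.2) : ℤ × ℤ × ℤ) := by
    rintro ⟨⟨a, b⟩, c⟩ ⟨⟨a', b'⟩, c'⟩ h
    simp only [Prod.mk.injEq] at h ⊢
    omega
  rw [← hsum.tsum_eq, ← hinj.tsum_eq]
  · rw [cubicTheta, theta, mul_assoc, tsum_mul_tsum_of_summable_norm (summable_norm_cubicTheta hq)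
      (summable_norm_thetaTerm (pow_ne_zero 3 hq0) hq3 (z ^ 3)), ← tsum_mul_left]
    refine tsum_congr fun y => ?_
    rw [if_pos ⟨y.2, by push_cast; ring⟩, thetaTerm_mul_thetaTerm_mul_thetaTerm hq0 hz,
      Nat.cast_ofNat]
  · rintro ⟨a, b, c⟩ h
    obtain ⟨m, hm⟩ : (3 : ℤ) ∣ a + (b + c) := by
      by_contra hd
      simp [hd] at h
    refine ⟨((a - m, b - m), m), ?_⟩
    simp only [Prod.mk.injEq]
    omega

end CubicThetaTrisection

section ThetaDerivative

variable {q z : ℂ}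

lemma multipliableLocallyUniformlyOn_one_sub_mul_pow (hq : ‖q‖ < 1) (r : ℝ) :
    MultipliableLocallyUniformlyOn (fun (j : ℕ) (x : ℂ) => 1 - x * q ^ j)
      (Metric.ball (0 : ℂ) r) := by
  simp only [sub_eq_add_neg]
  refine Summable.multipliableLocallyUniformlyOn_nat_one_add Metric.isOpen_ball
    ((summable_geometric_of_lt_one (norm_nonneg q) hq).mul_left r)
    (.of_forall fun n x hx => ?_) (fun n => by fun_prop)
  rw [norm_neg, norm_mul, norm_pow]
  gcongr
  exact (mem_ball_zero_iff.mp hx).le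

lemma differentiable_qPochInf (hq : ‖q‖ < 1) : Differentiable ℂ fun x => qPochInf x q := by
  intro x
  have hdiff : DifferentiableOn ℂ (fun x => qPochInf x q) (Metric.ball 0 (‖x‖ + 1)) :=
    (multipliableLocallyUniformlyOn_one_sub_mul_pow hq _).hasProdLocallyUniformlyOn.differentiableOn
      (.of_forall fun s => by fun_prop) Metric.isOpen_ball
  exact hdiff.differentiableAt (Metric.isOpen_ball.mem_nhds (by simp))

lemma hasDerivAt_qPochInf (hq : ‖q‖ < 1) (hz : z ≠ 0) (h : ∀ j, 1 - z * q ^ j ≠ 0) :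
    HasDerivAt (fun x => qPochInf x q) (-(qPochInf z q * lambertSeries z q) / z) z := by
  have hlog (j : ℕ) :
      logDeriv (fun x : ℂ => 1 - x * q ^ j) z = -z⁻¹ * (z * q ^ j / (1 - z * q ^ j)) := by
    have hderiv : HasDerivAt (fun x : ℂ => 1 - x * q ^ j) (-(q ^ j)) z := by
      simpa using ((hasDerivAt_id z).mul_const (q ^ j)).const_sub 1
    rw [logDeriv_apply, hderiv.deriv]
    field_simp
  have hsum := logDeriv_tprod_eq_tsum Metric.isOpen_ball
    (mem_ball_zero_iff.mpr (lt_add_one ‖z‖)) h (fun j => by fun_prop)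
    (by simpa only [hlog] using (summable_lambertSeries hq h).mul_left _)
    (multipliableLocallyUniformlyOn_one_sub_mul_pow hq _) (qPochInf_ne_zero hq h)
  simp only [hlog, tsum_mul_left] at hsum
  change deriv (fun x => qPochInf x q) z / qPochInf z q = -z⁻¹ * lambertSeries z q at hsum
  refine (differentiable_qPochInf hq z).hasDerivAt.congr_deriv ?_
  rw [(div_eq_iff (qPochInf_ne_zero hq h)).mp hsum]
  ring

lemma hasDerivAt_theta (hq0 : q ≠ 0) (hq : ‖q‖ < 1) (hz : z ≠ 0) (h : ∀ j, 1 - z * q ^ j ≠ 0)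
    (h' : ∀ j, 1 - q / z * q ^ j ≠ 0) :
    HasDerivAt (theta q) (theta q z * (lambertSeries (q / z) q - lambertSeries z q) / z) z := by
  have h1 := hasDerivAt_qPochInf hq hz h
  have hinv : HasDerivAt (fun y => q / y) (-q / z ^ 2) z := by
    simpa using (hasDerivAt_const z q).fun_div (hasDerivAt_id' z) hz
  have h2 := (hasDerivAt_qPochInf hq (div_ne_zero hq0 hz) h').comp z hinv
  refine (((h1.mul h2).const_mul (qPochInf q q)).congr_of_eventuallyEq ?_).congr_deriv ?_
  · filter_upwards [isOpen_ne.mem_nhds hz] with y hy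
    exact jacobi_triple_product hq0 hq hy
  · rw [jacobi_triple_product hq0 hq hz, Function.comp_apply]
    field_simp
    ring

lemma theta_eq (hq0 : q ≠ 0) (hq : ‖q‖ < 1) (hz : z ≠ 0) :
    theta q z = (1 - z) * (qPochInf q q * qPochInf (z * q) q * qPochInf (q / z) q) := by
  rw [jacobi_triple_product hq0 hq hz, ← qPoch_mul_qPochInf hq z 1, qPoch_one, pow_one]
  ring

lemma theta_one (hq0 : q ≠ 0) (hq : ‖q‖ < 1) : theta q 1 = 0 := by
  rw [theta_eq hq0 hq one_ne_zero, sub_self, zero_mul]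

lemma hasDerivAt_theta_one (hq0 : q ≠ 0) (hq : ‖q‖ < 1) :
    HasDerivAt (theta q) (-(qPochInf q q) ^ 3) 1 := by
  have hdiff : DifferentiableAt ℂ
      (fun z => qPochInf q q * qPochInf (z * q) q * qPochInf (q / z) q) 1 := by
    have h1 := (differentiable_qPochInf hq).differentiableAt.comp (1 : ℂ)
      (differentiableAt_id.mul_const q)
    have h2 := (differentiable_qPochInf hq).differentiableAt.comp (1 : ℂ)
      ((differentiableAt_const q).div differentiableAt_id one_ne_zero)
    exact (h1.const_mul _).mul h2
  refine ((((hasDerivAt_id (1 : ℂ)).const_sub 1).mul hdiff.hasDerivAt).congr_of_eventuallyEq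
    ?_).congr_deriv ?_
  · filter_upwards [isOpen_ne.mem_nhds one_ne_zero] with z hz
    exact theta_eq hq0 hq hz
  · simp only [id, sub_self, zero_mul, add_zero, one_mul, div_one]
    ring

end ThetaDerivative

section CubicThetaLambert

variable {q ζ : ℂ}

lemma lambertSeries_eq_add (hq : ‖q‖ < 1) {x : ℂ} (h : ∀ j, 1 - x * q ^ j ≠ 0) :
    lambertSeries x q = x / (1 - x) + lambertSeries (x * q) q := by
  rw [lambertSeries, (summable_lambertSeries hq h).tsum_eq_zero_add, lambertSeries]
  simp only [pow_zero, mul_one, pow_succ', mul_assoc]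

lemma one_add_add_sq_eq_zero (hζ : IsPrimitiveRoot ζ 3) : 1 + ζ + ζ ^ 2 = 0 := by
  simpa [Finset.sum_range_succ] using hζ.geom_sum_eq_zero (by norm_num)

lemma norm_mul_lt_one_of_isPrimitiveRoot (hζ : IsPrimitiveRoot ζ 3) (hq : ‖q‖ < 1) :
    ‖ζ * q‖ < 1 := by
  rwa [norm_mul, hζ.norm'_eq_one three_ne_zero, one_mul]

lemma one_sub_mul_pow_ne_zero_of_isPrimitiveRoot (hζ : IsPrimitiveRoot ζ 3) (hq : ‖q‖ < 1)
    (j : ℕ) : 1 - ζ * q ^ j ≠ 0 := by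
  cases j with
  | zero => simpa only [pow_zero, mul_one] using sub_ne_zero.mpr (hζ.ne_one (by norm_num)).symm
  | succ j =>
    simpa only [pow_succ', mul_assoc] using
      one_sub_mul_pow_ne_zero hq (norm_mul_lt_one_of_isPrimitiveRoot hζ hq) j

lemma div_eq_sq_mul_of_isPrimitiveRoot (hζ : IsPrimitiveRoot ζ 3) (q : ℂ) :
    q / ζ = ζ ^ 2 * q := by
  rw [div_eq_iff (hζ.ne_zero three_ne_zero)]
  linear_combination -q * hζ.pow_eq_one

lemma theta_of_isPrimitiveRoot (hζ : IsPrimitiveRoot ζ 3) (hq0 : q ≠ 0) (hq : ‖q‖ < 1) :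
    theta q ζ = (1 - ζ) * qPochInf (q ^ 3) (q ^ 3) := by
  rw [theta_eq hq0 hq (hζ.ne_zero three_ne_zero), div_eq_sq_mul_of_isPrimitiveRoot hζ,
    ← prod_qPochInf_pow_mul_of_isPrimitiveRoot (k := 3) three_pos hζ hq q]
  simp only [Finset.prod_range_succ, Finset.prod_range_zero, pow_zero, pow_one, one_mul]

lemma hasDerivAt_theta_mul_pow_three_one (hζ : IsPrimitiveRoot ζ 3) (hq0 : q ≠ 0)
    (hq : ‖q‖ < 1) :
    HasDerivAt (fun z => theta q (ζ * z) ^ 3)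
      (9 * (ζ ^ 2 - ζ) * qPochInf (q ^ 3) (q ^ 3) ^ 3 *
        (lambertSeries (ζ ^ 2 * q) q - lambertSeries (ζ * q) q - ζ / (1 - ζ))) 1 := by
  have hζ0 := hζ.ne_zero three_ne_zero
  have hne := one_sub_mul_pow_ne_zero_of_isPrimitiveRoot hζ hq
  have hne' := one_sub_mul_pow_ne_zero hq
    (norm_mul_lt_one_of_isPrimitiveRoot (hζ.pow_of_coprime 2 (by norm_num)) hq)
  have hdiv := div_eq_sq_mul_of_isPrimitiveRoot hζ q
  have h := hasDerivAt_theta hq0 hq hζ0 hne (by rwa [hdiv])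
  rw [hdiv, lambertSeries_eq_add hq hne] at h
  have hmul : HasDerivAt (fun z => ζ * z) ζ 1 := by simpa using (hasDerivAt_id (1 : ℂ)).const_mul ζ
  have hcomp := (HasDerivAt.comp (h₂ := theta q) 1 (by rwa [mul_one]) hmul).fun_pow 3
  refine hcomp.congr_deriv ?_
  simp only [Function.comp_apply, mul_one, theta_of_isPrimitiveRoot hζ hq0 hq]
  have hcube : (1 - ζ) ^ 3 = 3 * (ζ ^ 2 - ζ) := by linear_combination -hζ.pow_eq_one
  rw [div_mul_cancel₀ _ hζ0]
  push_cast
  linear_combination 3 * qPochInf (q ^ 3) (q ^ 3) ^ 3 *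
    (lambertSeries (ζ ^ 2 * q) q - lambertSeries (ζ * q) q - ζ / (1 - ζ)) * hcube

lemma cubicTheta_eq_of_isPrimitiveRoot (hζ : IsPrimitiveRoot ζ 3) (hq0 : q ≠ 0) (hq : ‖q‖ < 1) :
    cubicTheta q =
      1 + 2 * (ζ - ζ ^ 2) * (lambertSeries (ζ ^ 2 * q) q - lambertSeries (ζ * q) q) := by
  have hq3 : ‖q ^ 3‖ < 1 := norm_pow_lt_one hq three_ne_zero
  have hE := qPochInf_ne_zero hq3 (one_sub_mul_pow_ne_zero hq3 hq3)
  have hζ2 := hζ.pow_of_coprime 2 (by norm_num)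
  have hζ4 : (ζ ^ 2) ^ 2 = ζ := by linear_combination ζ * hζ.pow_eq_one
  have hleft := (((hasDerivAt_theta_one hq0 hq).fun_pow 3).add
    (hasDerivAt_theta_mul_pow_three_one hζ hq0 hq)).add
    (hasDerivAt_theta_mul_pow_three_one hζ2 hq0 hq)
  have hright := (HasDerivAt.comp (h₂ := theta (q ^ 3)) 1
    (by rw [one_pow]; exact hasDerivAt_theta_one (pow_ne_zero 3 hq0) hq3)
    (hasDerivAt_pow 3 (1 : ℂ))).const_mul (3 * cubicTheta q)
  have hderiv := hleft.unique (hright.congr_of_eventuallyEq (by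
    filter_upwards [isOpen_ne.mem_nhds one_ne_zero] with z hz
    simpa [Finset.sum_range_succ] using sum_theta_pow_three hζ hq0 hq hz))
  rw [theta_one hq0 hq, hζ4] at hderiv
  have hne := sub_ne_zero.mpr (hζ.ne_one (by norm_num)).symm
  have hne2 := sub_ne_zero.mpr (hζ2.ne_one (by norm_num)).symm
  have hone := one_add_add_sq_eq_zero hζ
  have hmul : (1 - ζ) * (1 - ζ ^ 2) = 3 := by linear_combination hζ.pow_eq_one - hone
  have hsq : (ζ - ζ ^ 2) ^ 2 = -3 := by linear_combination (ζ - 2) * hζ.pow_eq_one + hone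
  have hsum : ζ / (1 - ζ) - ζ ^ 2 / (1 - ζ ^ 2) = (ζ - ζ ^ 2) / 3 := by
    rw [div_sub_div _ _ hne hne2, hmul]
    ring
  refine mul_left_cancel₀ (pow_ne_zero 3 hE) ?_
  push_cast at hderiv
  linear_combination hderiv / 9 - (ζ - ζ ^ 2) * qPochInf (q ^ 3) (q ^ 3) ^ 3 * hsum -
    qPochInf (q ^ 3) (q ^ 3) ^ 3 / 3 * hsq

lemma div_sub_div_of_isPrimitiveRoot (hζ : IsPrimitiveRoot ζ 3) {x : ℂ} (hx : 1 - x ^ 3 ≠ 0) :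
    (ζ - ζ ^ 2) * (ζ ^ 2 * x / (1 - ζ ^ 2 * x) - ζ * x / (1 - ζ * x)) =
      3 * (x / (1 - x ^ 3) - x ^ 2 / (1 - x ^ 3)) := by
  have hone := one_add_add_sq_eq_zero hζ
  have hfactor : (1 - x) * ((1 - ζ ^ 2 * x) * (1 - ζ * x)) = 1 - x ^ 3 := by
    rw [← prod_one_sub_pow_mul_of_isPrimitiveRoot (k := 3) three_pos hζ x]
    simp only [Finset.prod_range_succ, Finset.prod_range_zero, pow_zero, pow_one, one_mul]
    ring
  rw [← hfactor] at hx ⊢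
  obtain ⟨hx0, hx'⟩ := mul_ne_zero_iff.mp hx
  obtain ⟨hx2, hx1⟩ := mul_ne_zero_iff.mp hx'
  rw [← sub_div, show x - x ^ 2 = (1 - x) * x by ring, mul_div_mul_left _ _ hx0,
    div_sub_div _ _ hx2 hx1, mul_div, mul_div]
  congr 1
  linear_combination -x * ((ζ - 2) * hζ.pow_eq_one + hone)

theorem cubicTheta_eq_lambertSeries (hq : ‖q‖ < 1) :
    cubicTheta q = 1 + 6 * (lambertSeries q (q ^ 3) - lambertSeries (q ^ 2) (q ^ 3)) := by
  obtain rfl | hq0 := eq_or_ne q 0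
  · simp [cubicTheta_zero, lambertSeries]
  obtain ⟨ζ, hζ⟩ : ∃ ζ : ℂ, IsPrimitiveRoot ζ 3 := ⟨_, Complex.isPrimitiveRoot_exp 3 three_ne_zero⟩
  have hq2 : ‖q ^ 2‖ < 1 := norm_pow_lt_one hq two_ne_zero
  have hq3 : ‖q ^ 3‖ < 1 := norm_pow_lt_one hq three_ne_zero
  have hsum {ω : ℂ} (hω : IsPrimitiveRoot ω 3) :=
    hasSum_lambertSeries hq
      (one_sub_mul_pow_ne_zero hq (norm_mul_lt_one_of_isPrimitiveRoot hω hq))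
  have hleft := ((hsum (hζ.pow_of_coprime 2 (by norm_num))).sub (hsum hζ)).mul_left (ζ - ζ ^ 2)
  have hright := ((hasSum_pow_div_one_sub_pow hq3 hq).sub
    (hasSum_pow_div_one_sub_pow hq3 hq2)).mul_left 3
  have key := hleft.unique (hright.congr_fun fun j => ?_)
  · rw [cubicTheta_eq_of_isPrimitiveRoot hζ hq0 hq]
    linear_combination 2 * key
  · have hj : 1 - (q ^ (j + 1)) ^ 3 ≠ 0 := by
      rw [pow_right_comm]
      exact one_sub_pow_succ_ne_zero hq3 j
    simpa only [mul_assoc _ q, ← pow_succ', pow_right_comm q 3, pow_right_comm q 2] using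
      div_sub_div_of_isPrimitiveRoot hζ hj

end CubicThetaLambert

section Expansions

variable {q : ℂ}

lemma two_mul_choose_two_add (n : ℕ) : 2 * n.choose 2 + n = n ^ 2 := by
  induction n with
  | zero => rfl
  | succ n ih => linarith [choose_two_succ n]

lemma pow_pentagonal_sub (q : ℂ) (n : ℕ) :
    q ^ ((3 * n ^ 2 - n) / 2) = (q ^ 3) ^ n.choose 2 * q ^ n := by
  rw [← pow_mul, ← pow_add]
  congr 1
  have := two_mul_choose_two_add n
  omega

lemma pow_pentagonal_add (q : ℂ) (n : ℕ) :
    q ^ ((3 * n ^ 2 + n) / 2) = (q ^ 3) ^ n.choose 2 * (q ^ 2) ^ n := by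
  rw [← pow_mul, ← pow_mul, ← pow_add]
  congr 1
  have := two_mul_choose_two_add n
  omega

lemma pow_three_mul_sq_sub (q : ℂ) (n : ℕ) :
    q ^ (3 * n ^ 2 - n) = ((q ^ 3) ^ n.choose 2 * q ^ n) ^ 2 := by
  rw [← pow_mul, ← pow_add, ← pow_mul]
  congr 1
  have := two_mul_choose_two_add n
  omega

lemma pow_three_mul_sq_add (q : ℂ) (n : ℕ) :
    q ^ (3 * n ^ 2 + n) = ((q ^ 3) ^ n.choose 2 * (q ^ 2) ^ n) ^ 2 := by
  rw [← pow_mul, ← pow_mul, ← pow_add, ← pow_mul]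
  congr 1
  have := two_mul_choose_two_add n
  omega

lemma hasSum_pentagonal_sub (hq : ‖q‖ < 1) :
    HasSum (fun n : ℕ+ => (-1 : ℂ) ^ (n : ℕ) * q ^ ((3 * (n : ℕ) ^ 2 - n) / 2) /
      (qPoch q (q ^ 3) n * (1 - q ^ (3 * (n : ℕ))))) (-lambertSeries q (q ^ 3)) := by
  have hq3 := norm_pow_lt_one hq three_ne_zero
  refine (hasSum_pnat_iff_hasSum_succ (f := fun n => (-1 : ℂ) ^ n * q ^ ((3 * n ^ 2 - n) / 2) /
    (qPoch q (q ^ 3) n * (1 - q ^ (3 * n))))).mpr ?_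
  simpa only [pow_pentagonal_sub, mul_assoc, pow_mul q 3] using
    hasSum_lambertSeries_alternating hq3 (one_sub_mul_pow_ne_zero hq3 hq)

lemma hasSum_pentagonal_add (hq : ‖q‖ < 1) :
    HasSum (fun n : ℕ+ => (-1 : ℂ) ^ (n : ℕ) * q ^ ((3 * (n : ℕ) ^ 2 + n) / 2) /
      (qPoch (q ^ 2) (q ^ 3) n * (1 - q ^ (3 * (n : ℕ))))) (-lambertSeries (q ^ 2) (q ^ 3)) := by
  have hq2 := norm_pow_lt_one hq two_ne_zero
  have hq3 := norm_pow_lt_one hq three_ne_zero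
  refine (hasSum_pnat_iff_hasSum_succ (f := fun n => (-1 : ℂ) ^ n * q ^ ((3 * n ^ 2 + n) / 2) /
    (qPoch (q ^ 2) (q ^ 3) n * (1 - q ^ (3 * n))))).mpr ?_
  simpa only [pow_pentagonal_add, mul_assoc, pow_mul q 3] using
    hasSum_lambertSeries_alternating hq3 (one_sub_mul_pow_ne_zero hq3 hq2)

lemma hasSum_clausen_sub_two (hq : ‖q‖ < 1) :
    HasSum (fun n : ℕ+ => q ^ (3 * (n : ℕ) ^ 2 - 2 * n) * (1 - q ^ (6 * (n : ℕ) - 2)) /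
      ((1 - q ^ (3 * (n : ℕ) - 2)) * (1 - q ^ (3 * (n : ℕ))))) (lambertSeries q (q ^ 3)) := by
  have hq3 := norm_pow_lt_one hq three_ne_zero
  refine (hasSum_pnat_iff_hasSum_succ (f := fun n => q ^ (3 * n ^ 2 - 2 * n) *
    (1 - q ^ (6 * n - 2)) / ((1 - q ^ (3 * n - 2)) * (1 - q ^ (3 * n))))).mpr ?_
  refine (hasSum_lambertSeries_clausen hq3 (one_sub_mul_pow_ne_zero hq3 hq)).congr_fun fun n => ?_
  have hexp : 3 * (n + 1) ^ 2 - 2 * (n + 1) = n + 1 + 3 * (n + 1).choose 2 * 2 := by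
    have := two_mul_choose_two_add (n + 1)
    omega
  rw [hexp, show 6 * (n + 1) - 2 = 1 + 3 * (2 * n + 1) by omega,
    show 3 * (n + 1) - 2 = 1 + 3 * n by omega]
  simp only [pow_add q 1, pow_add q (n + 1), pow_mul, pow_one]

lemma hasSum_clausen_sub_one (hq : ‖q‖ < 1) :
    HasSum (fun n : ℕ+ => q ^ (3 * (n : ℕ) ^ 2 - n) * (1 - q ^ (6 * (n : ℕ) - 1)) /
      ((1 - q ^ (3 * (n : ℕ) - 1)) * (1 - q ^ (3 * (n : ℕ)))))
      (lambertSeries (q ^ 2) (q ^ 3)) := by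
  have hq2 := norm_pow_lt_one hq two_ne_zero
  have hq3 := norm_pow_lt_one hq three_ne_zero
  refine (hasSum_pnat_iff_hasSum_succ (f := fun n => q ^ (3 * n ^ 2 - n) *
    (1 - q ^ (6 * n - 1)) / ((1 - q ^ (3 * n - 1)) * (1 - q ^ (3 * n))))).mpr ?_
  refine (hasSum_lambertSeries_clausen hq3 (one_sub_mul_pow_ne_zero hq3 hq2)).congr_fun
    fun n => ?_
  have hexp : 3 * (n + 1) ^ 2 - (n + 1) = 2 * (n + 1) + 3 * (n + 1).choose 2 * 2 := by
    have := two_mul_choose_two_add (n + 1)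
    omega
  rw [hexp, show 6 * (n + 1) - 1 = 2 + 3 * (2 * n + 1) by omega,
    show 3 * (n + 1) - 1 = 2 + 3 * n by omega]
  simp only [pow_add q 2, pow_add q (2 * (n + 1)), pow_mul]

lemma inv_mul_pow_three (hq0 : q ≠ 0) : q⁻¹ * q ^ 3 = q ^ 2 := by
  field_simp

lemma inv_sq_mul_pow_three (hq0 : q ≠ 0) : (q ^ 2)⁻¹ * q ^ 3 = q := by
  field_simp

lemma IsBaileyPair.seriesTendsTo_inv {α β : ℕ → ℂ} {A : ℂ} (h : IsBaileyPair q⁻¹ (q ^ 3) α β)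
    (hq0 : q ≠ 0) (hq : ‖q‖ < 1)
    (hA : SeriesTendsTo (fun n => qPoch (q ^ 3) (q ^ 3) (n - 1) * (-1) ^ n *
      q ^ ((3 * n ^ 2 + n) / 2) * α n / qPoch (q ^ 2) (q ^ 3) n) A) :
    SeriesTendsTo (fun n => qPoch (q ^ 3) (q ^ 3) (n - 1) * (-1) ^ n *
      q ^ ((3 * n ^ 2 + n) / 2) * β n) (A - lambertSeries (q ^ 2) (q ^ 3)) := by
  have hq2 := norm_pow_lt_one hq two_ne_zero
  have hq3 := norm_pow_lt_one hq three_ne_zero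
  have htransform := h.seriesTendsTo (A := A) hq3
  rw [inv_mul_pow_three hq0] at htransform
  simp only [pow_pentagonal_add, ← mul_assoc] at hA ⊢
  exact htransform (one_sub_mul_pow_ne_zero hq3 hq2) hA

lemma IsBaileyPair.seriesTendsTo_inv_sq {α β : ℕ → ℂ} {A : ℂ}
    (h : IsBaileyPair (q ^ 2)⁻¹ (q ^ 3) α β) (hq0 : q ≠ 0) (hq : ‖q‖ < 1)
    (hA : SeriesTendsTo (fun n => qPoch (q ^ 3) (q ^ 3) (n - 1) * (-1) ^ n *
      q ^ ((3 * n ^ 2 - n) / 2) * α n / qPoch q (q ^ 3) n) A) :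
    SeriesTendsTo (fun n => qPoch (q ^ 3) (q ^ 3) (n - 1) * (-1) ^ n *
      q ^ ((3 * n ^ 2 - n) / 2) * β n) (A - lambertSeries q (q ^ 3)) := by
  have hq3 := norm_pow_lt_one hq three_ne_zero
  have htransform := h.seriesTendsTo (A := A) hq3
  rw [inv_sq_mul_pow_three hq0] at htransform
  simp only [pow_pentagonal_sub, ← mul_assoc] at hA ⊢
  exact htransform (one_sub_mul_pow_ne_zero hq3 hq) hA

lemma one_sub_div_mul_pow_ne_zero {c : ℂ} (hc : c ≠ 0) {r m : ℕ} (h : c ≠ q ^ (3 * m + r)) :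
    1 - q ^ r / c * (q ^ 3) ^ m ≠ 0 := by
  rw [sub_ne_zero, div_mul_eq_mul_div, ← pow_mul, ← pow_add, add_comm, ne_eq,
    eq_div_iff hc, one_mul]
  exact h

lemma inv_mul_pow_three_pow (hq0 : q ≠ 0) {n : ℕ} (hn : 0 < n) :
    q⁻¹ * (q ^ 3) ^ n = q ^ (3 * n - 1) := by
  rw [inv_mul_eq_iff_eq_mul₀ hq0, ← pow_mul, ← pow_succ']
  congr 1
  omega

lemma inv_sq_mul_pow_three_pow (hq0 : q ≠ 0) {n : ℕ} (hn : 0 < n) :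
    (q ^ 2)⁻¹ * (q ^ 3) ^ n = q ^ (3 * n - 2) := by
  rw [inv_mul_eq_iff_eq_mul₀ (pow_ne_zero 2 hq0), ← pow_mul, ← pow_add]
  congr 1
  omega

lemma one_sub_inv_ne_zero {x : ℂ} (hx : ‖x‖ < 1) : 1 - x⁻¹ ≠ 0 := by
  rw [sub_ne_zero, ne_comm, ne_eq, inv_eq_one, eq_comm, ← sub_eq_zero]
  exact one_sub_ne_zero_of_norm_lt_one hx

lemma one_sub_inv_mul_pow_ne_zero (hq0 : q ≠ 0) (hq : ‖q‖ < 1) (m : ℕ) :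
    1 - q⁻¹ * (q ^ 3) ^ m ≠ 0 := by
  obtain rfl | hm := m.eq_zero_or_pos
  · simpa only [pow_zero, mul_one] using one_sub_inv_ne_zero hq
  · rw [inv_mul_pow_three_pow hq0 hm]
    exact one_sub_ne_zero_of_norm_lt_one (norm_pow_lt_one hq (by omega))

lemma one_sub_inv_sq_mul_pow_ne_zero (hq0 : q ≠ 0) (hq : ‖q‖ < 1) (m : ℕ) :
    1 - (q ^ 2)⁻¹ * (q ^ 3) ^ m ≠ 0 := by
  obtain rfl | hm := m.eq_zero_or_pos
  · simpa only [pow_zero, mul_one] using one_sub_inv_ne_zero (norm_pow_lt_one hq two_ne_zero)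
  · rw [inv_sq_mul_pow_three_pow hq0 hm]
    exact one_sub_ne_zero_of_norm_lt_one (norm_pow_lt_one hq (by omega))

lemma exists_hasSum_wellPoised_inv (hq0 : q ≠ 0) (hq : ‖q‖ < 1) {c d : ℂ} (hc : c ≠ 0)
    (hd : d ≠ 0) (hcm : ∀ m, c ≠ q ^ (3 * m + 2)) (hdm : ∀ m, d ≠ q ^ (3 * m + 2)) :
    ∃ A B : ℂ,
      HasSum (fun n : ℕ+ =>
        qPoch (q ^ 3) (q ^ 3) (n - 1) * qPoch (q ^ 2 / (c * d)) (q ^ 3) n *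
            (-1) ^ (n : ℕ) * q ^ ((3 * (n : ℕ) ^ 2 + n) / 2) /
          (qPoch (q ^ 2 / c) (q ^ 3) n * qPoch (q ^ 2 / d) (q ^ 3) n *
            qPoch (q ^ 3) (q ^ 3) n)) B ∧
      HasSum (fun n : ℕ+ =>
        (1 - q ^ (6 * (n : ℕ) - 1)) * qPoch (q ^ 3) (q ^ 3) (n - 1) *
            (qPoch (1 / q) (q ^ 3) n * qPoch c (q ^ 3) n * qPoch d (q ^ 3) n) *
            q ^ (3 * (n : ℕ) ^ 2 + n) /
          ((1 - 1 / q) * (qPoch (q ^ 2 / c) (q ^ 3) n * qPoch (q ^ 2 / d) (q ^ 3) n *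
            qPoch (q ^ 2) (q ^ 3) n * qPoch (q ^ 3) (q ^ 3) n) *
            c ^ (n : ℕ) * d ^ (n : ℕ))) A ∧
      B = A - lambertSeries (q ^ 2) (q ^ 3) := by
  have hx := inv_mul_pow_three hq0
  obtain ⟨A, B, hB, hA, hAB⟩ := exists_hasSum_wellPoised (norm_pow_lt_one hq three_ne_zero) hc hd
    (one_sub_inv_mul_pow_ne_zero hq0 hq)
    (by simpa only [hx] using fun m => one_sub_div_mul_pow_ne_zero hc (hcm m))
    (by simpa only [hx] using fun m => one_sub_div_mul_pow_ne_zero hd (hdm m))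
  simp only [baileyWeight_mul_wellPoisedAlpha] at hA
  rw [hx] at hAB
  refine ⟨A, B, hB.congr_fun fun n => ?_, hA.congr_fun fun n => ?_, hAB⟩
  · rw [baileyWeight, wellPoisedBeta, hx, pow_pentagonal_add]
    ring
  · rw [hx, inv_mul_pow_three_pow hq0 (by positivity), ← pow_three_mul_sq_add, one_div,
      show 3 * (2 * (n : ℕ)) = 6 * n by ring]

lemma exists_hasSum_wellPoised_inv_sq (hq0 : q ≠ 0) (hq : ‖q‖ < 1) {c d : ℂ} (hc : c ≠ 0)
    (hd : d ≠ 0) (hcm : ∀ m, c ≠ q ^ (3 * m + 1)) (hdm : ∀ m, d ≠ q ^ (3 * m + 1)) :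
    ∃ A B : ℂ,
      HasSum (fun n : ℕ+ =>
        qPoch (q ^ 3) (q ^ 3) (n - 1) * qPoch (q / (c * d)) (q ^ 3) n *
            (-1) ^ (n : ℕ) * q ^ ((3 * (n : ℕ) ^ 2 - n) / 2) /
          (qPoch (q / c) (q ^ 3) n * qPoch (q / d) (q ^ 3) n *
            qPoch (q ^ 3) (q ^ 3) n)) B ∧
      HasSum (fun n : ℕ+ =>
        (1 - q ^ (6 * (n : ℕ) - 2)) * qPoch (q ^ 3) (q ^ 3) (n - 1) *
            (qPoch (1 / q ^ 2) (q ^ 3) n * qPoch c (q ^ 3) n * qPoch d (q ^ 3) n) *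
            q ^ (3 * (n : ℕ) ^ 2 - n) /
          ((1 - 1 / q ^ 2) * (qPoch (q / c) (q ^ 3) n * qPoch (q / d) (q ^ 3) n *
            qPoch q (q ^ 3) n * qPoch (q ^ 3) (q ^ 3) n) *
            c ^ (n : ℕ) * d ^ (n : ℕ))) A ∧
      B = A - lambertSeries q (q ^ 3) := by
  have hx := inv_sq_mul_pow_three hq0
  obtain ⟨A, B, hB, hA, hAB⟩ := exists_hasSum_wellPoised (norm_pow_lt_one hq three_ne_zero) hc hd
    (one_sub_inv_sq_mul_pow_ne_zero hq0 hq)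
    (by simpa only [hx, pow_one] using fun m => one_sub_div_mul_pow_ne_zero hc (hcm m))
    (by simpa only [hx, pow_one] using fun m => one_sub_div_mul_pow_ne_zero hd (hdm m))
  simp only [baileyWeight_mul_wellPoisedAlpha] at hA
  rw [hx] at hAB
  refine ⟨A, B, hB.congr_fun fun n => ?_, hA.congr_fun fun n => ?_, hAB⟩
  · rw [baileyWeight, wellPoisedBeta, hx, pow_pentagonal_sub]
    ring
  · rw [hx, inv_sq_mul_pow_three_pow hq0 (by positivity), ← pow_three_mul_sq_sub, one_div,
      show 3 * (2 * (n : ℕ)) = 6 * n by ring]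

end Expansions

theorem mainTheorem8 :
    -- the double series for `a(q)` converges absolutely, and the first two expansions
    (∀ q : ℂ, ‖q‖ < 1 →
      Summable (fun p : ℤ × ℤ => q ^ (p.1 ^ 2 + p.1 * p.2 + p.2 ^ 2)) ∧
      (∃ S₁ S₂ : ℂ,
        HasSum (fun n : ℕ+ => (-1 : ℂ) ^ (n : ℕ) * q ^ ((3 * (n : ℕ) ^ 2 - n) / 2) /
          (qPoch q (q ^ 3) n * (1 - q ^ (3 * (n : ℕ))))) S₁ ∧
        HasSum (fun n : ℕ+ => (-1 : ℂ) ^ (n : ℕ) * q ^ ((3 * (n : ℕ) ^ 2 + n) / 2) /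
          (qPoch (q ^ 2) (q ^ 3) n * (1 - q ^ (3 * (n : ℕ))))) S₂ ∧
        cubicTheta q = 1 - 6 * S₁ + 6 * S₂) ∧
      (∃ S₁ S₂ : ℂ,
        HasSum (fun n : ℕ+ => q ^ (3 * (n : ℕ) ^ 2 - 2 * n) * (1 - q ^ (6 * (n : ℕ) - 2)) /
          ((1 - q ^ (3 * (n : ℕ) - 2)) * (1 - q ^ (3 * (n : ℕ))))) S₁ ∧
        HasSum (fun n : ℕ+ => q ^ (3 * (n : ℕ) ^ 2 - n) * (1 - q ^ (6 * (n : ℕ) - 1)) /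
          ((1 - q ^ (3 * (n : ℕ) - 1)) * (1 - q ^ (3 * (n : ℕ))))) S₂ ∧
        cubicTheta q = 1 + 6 * S₁ - 6 * S₂)) ∧
    -- the general formula, for every Bailey pair `(α_n(a, q), β_n(a, q))` with free parameter `a`
    (∀ q : ℂ, 0 < ‖q‖ → ‖q‖ < 1 →
      ∀ α β : ℂ → ℂ → ℕ → ℂ,
        IsBaileyPair q⁻¹ (q ^ 3) (α q⁻¹ (q ^ 3)) (β q⁻¹ (q ^ 3)) →
        IsBaileyPair (q ^ 2)⁻¹ (q ^ 3) (α (q ^ 2)⁻¹ (q ^ 3)) (β (q ^ 2)⁻¹ (q ^ 3)) →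
      ∀ A₁ A₂ : ℂ,
        SeriesTendsTo (fun n => qPoch (q ^ 3) (q ^ 3) (n - 1) * (-1) ^ n *
          q ^ ((3 * n ^ 2 + n) / 2) * α q⁻¹ (q ^ 3) n / qPoch (q ^ 2) (q ^ 3) n) A₁ →
        SeriesTendsTo (fun n => qPoch (q ^ 3) (q ^ 3) (n - 1) * (-1) ^ n *
          q ^ ((3 * n ^ 2 - n) / 2) * α (q ^ 2)⁻¹ (q ^ 3) n / qPoch q (q ^ 3) n) A₂ →
      ∃ B₁ B₂ : ℂ,
        SeriesTendsTo (fun n => qPoch (q ^ 3) (q ^ 3) (n - 1) * (-1) ^ n *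
          q ^ ((3 * n ^ 2 + n) / 2) * β q⁻¹ (q ^ 3) n) B₁ ∧
        SeriesTendsTo (fun n => qPoch (q ^ 3) (q ^ 3) (n - 1) * (-1) ^ n *
          q ^ ((3 * n ^ 2 - n) / 2) * β (q ^ 2)⁻¹ (q ^ 3) n) B₂ ∧
        cubicTheta q = 1 + 6 * B₁ - 6 * B₂ - 6 * A₁ + 6 * A₂) ∧
    -- the formula with two free parameters `c` and `d`
    (∀ q : ℂ, 0 < ‖q‖ → ‖q‖ < 1 →
      ∀ c d : ℂ, c ≠ 0 → d ≠ 0 →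
        (∀ m : ℕ, c ≠ q ^ (3 * m + 1) ∧ c ≠ q ^ (3 * m + 2) ∧
          d ≠ q ^ (3 * m + 1) ∧ d ≠ q ^ (3 * m + 2)) →
      ∃ S₁ S₂ S₃ S₄ : ℂ,
        HasSum (fun n : ℕ+ =>
          qPoch (q ^ 3) (q ^ 3) (n - 1) * qPoch (q ^ 2 / (c * d)) (q ^ 3) n *
              (-1) ^ (n : ℕ) * q ^ ((3 * (n : ℕ) ^ 2 + n) / 2) /
            (qPoch (q ^ 2 / c) (q ^ 3) n * qPoch (q ^ 2 / d) (q ^ 3) n *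
              qPoch (q ^ 3) (q ^ 3) n)) S₁ ∧
        HasSum (fun n : ℕ+ =>
          qPoch (q ^ 3) (q ^ 3) (n - 1) * qPoch (q / (c * d)) (q ^ 3) n *
              (-1) ^ (n : ℕ) * q ^ ((3 * (n : ℕ) ^ 2 - n) / 2) /
            (qPoch (q / c) (q ^ 3) n * qPoch (q / d) (q ^ 3) n *
              qPoch (q ^ 3) (q ^ 3) n)) S₂ ∧
        HasSum (fun n : ℕ+ =>
          (1 - q ^ (6 * (n : ℕ) - 1)) * qPoch (q ^ 3) (q ^ 3) (n - 1) *
              (qPoch (1 / q) (q ^ 3) n * qPoch c (q ^ 3) n * qPoch d (q ^ 3) n) *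
              q ^ (3 * (n : ℕ) ^ 2 + n) /
            ((1 - 1 / q) * (qPoch (q ^ 2 / c) (q ^ 3) n * qPoch (q ^ 2 / d) (q ^ 3) n *
              qPoch (q ^ 2) (q ^ 3) n * qPoch (q ^ 3) (q ^ 3) n) *
              c ^ (n : ℕ) * d ^ (n : ℕ))) S₃ ∧
        HasSum (fun n : ℕ+ =>
          (1 - q ^ (6 * (n : ℕ) - 2)) * qPoch (q ^ 3) (q ^ 3) (n - 1) *
              (qPoch (1 / q ^ 2) (q ^ 3) n * qPoch c (q ^ 3) n * qPoch d (q ^ 3) n) *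
              q ^ (3 * (n : ℕ) ^ 2 - n) /
            ((1 - 1 / q ^ 2) * (qPoch (q / c) (q ^ 3) n * qPoch (q / d) (q ^ 3) n *
              qPoch q (q ^ 3) n * qPoch (q ^ 3) (q ^ 3) n) *
              c ^ (n : ℕ) * d ^ (n : ℕ))) S₄ ∧
        cubicTheta q = 1 + 6 * S₁ - 6 * S₂ - 6 * S₃ + 6 * S₄) := by
  refine ⟨fun q hq => ⟨(summable_norm_cubicTheta hq).of_norm,
    ⟨_, _, hasSum_pentagonal_sub hq, hasSum_pentagonal_add hq, ?_⟩,
    ⟨_, _, hasSum_clausen_sub_two hq, hasSum_clausen_sub_one hq, ?_⟩⟩,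
    fun q hq0 hq α β h h' A₁ A₂ hA₁ hA₂ => ?_, fun q hq0 hq c d hc hd hcd => ?_⟩
  · rw [cubicTheta_eq_lambertSeries hq]
    ring
  · rw [cubicTheta_eq_lambertSeries hq]
    ring
  · rw [norm_pos_iff] at hq0
    refine ⟨_, _, h.seriesTendsTo_inv hq0 hq hA₁, h'.seriesTendsTo_inv_sq hq0 hq hA₂, ?_⟩
    rw [cubicTheta_eq_lambertSeries hq]
    ring
  · rw [norm_pos_iff] at hq0
    obtain ⟨A₁, B₁, hB₁, hA₁, h₁⟩ := exists_hasSum_wellPoised_inv hq0 hq hc hd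
      (fun m => (hcd m).2.1) (fun m => (hcd m).2.2.2)
    obtain ⟨A₂, B₂, hB₂, hA₂, h₂⟩ := exists_hasSum_wellPoised_inv_sq hq0 hq hc hd
      (fun m => (hcd m).1) (fun m => (hcd m).2.2.1)
    refine ⟨B₁, B₂, A₁, A₂, hB₁, hB₂, hA₁, hA₂, ?_⟩
    rw [cubicTheta_eq_lambertSeries hq, h₁, h₂]
    ring
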